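/- Let $\mathbb{K}$ be a field of arbitrary characteristic, let $n\geq 0$ be an integer and let $Q=(q_{ij})$ be a multiplicatively antisymmetric $n\times n$ matrix over $\mathbb{K}$, that is, $q_{ii}=1$, $q_{ij}\neq 0$ and $q_{ji}=q_{ij}^{-1}$ for all $i,j$. Let $\mathcal{T}=\mathcal{O}_Q((\mathbb{K}^*)^n)$ be the quantum torus, that is, the $\mathbb{K}$-algebra generated by $x_1^{\pm1},\dots,x_n^{\pm1}$ subject to the relations $x_ix_j=q_{ij}x_jx_i$ for $i<j$ and $x_ix_i^{-1}=1=x_i^{-1}x_i$. Let $\sigma$ be a toric automorphism of $\mathcal{T}$, that is, a $\mathbb{K}$-algebra automorphism such that $\sigma(x_i)=\lambda_ix_i$ for some $\lambda_1,\dots,\lambda_n\in\mathbb{K}^*$, and let $\delta$ be a $\sigma$-derivation of $\mathcal{T}$, that is, a $\mathbb{K}$-linear map such that $\delta(rs)=\sigma(r)\delta(s)+\delta(r)s$ for all $r,s\in\mathcal{T}$. Let $S=\mathcal{T}[x;\sigma,\delta]$ be an Ore extension, that is, a $\mathbb{K}$-algebra extension of $\mathcal{T}$ that is free as a left $\mathcal{T}$-module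 with basis $1,x,x^2,\dots$ and satisfies $xr=\sigma(r)x+\delta(r)$ for all $r\in\mathcal{T}$. The automorphism $\sigma$ is inner if there is a unit $s$ of $\mathcal{T}$ such that $\sigma(r)=s^{-1}rs$ for all $r\in\mathcal{T}$, and outer otherwise. The $\sigma$-derivation $\delta$ is inner if there is $a\in\mathcal{T}$ such that $\delta(r)=ar-\sigma(r)a$ for all $r\in\mathcal{T}$ (in particular, $\delta=0$ is inner), and outer otherwise. Then $S$ has a quotient division algebra $D$ (a division $\mathbb{K}$-algebra containing $S$ in which every element has the form $as^{-1}$ and also the form $t^{-1}b$ with $a,b,s,t\in S$ and $s,t\neq0$), and the following hold. 1. If $\sigma$ is inner and $\delta$ is outer, then $D$ contains a copy of the first Weyl algebra $A_1=\mathbb{K}\langle p,q\mid pq-qp=1\rangle$ (that is, there is an injective $\mathbb{K}$-algebra homomorphism $A_1\to D$). 2. If $\sigma$ is outer or $\delta$ is inner (in particular, if $\delta=0$), then $D$ is the quotient division algebra of a quantum torus $\mathcal{O}_{Q'}((\mathbb{K}^*)^{n+1})$ for some multiplicatively antisymmetric $(n+1)\times(n+1)$ matrix $Q'$ over $\mathbb{K}$.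 -/

import Mathlib

universe u w v

/-- A square matrix `Q = (q_{ij})` over a field is multiplicatively antisymmetric if
`q_{ii} = 1`, `q_{ij} ≠ 0` and `q_{ji} = q_{ij}⁻¹` for all `i, j`. -/
structure IsMultAntisymm {K : Type*} [Field K] {n : ℕ} (Q : Matrix (Fin n) (Fin n) K) : Prop where
  diag : ∀ i, Q i i = 1
  ne_zero : ∀ i j, Q i j ≠ 0
  inv : ∀ i j, Q j i = (Q i j)⁻¹

/-- The defining relations of the quantum torus on the free algebra with generators
`Sum.inl i` (for `x_i`) and `Sum.inr i` (for `x_i⁻¹`). -/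
inductive QuantumTorusRel {K : Type*} [Field K] {n : ℕ} (Q : Matrix (Fin n) (Fin n) K) :
    FreeAlgebra K (Fin n ⊕ Fin n) → FreeAlgebra K (Fin n ⊕ Fin n) → Prop
  | comm (i j : Fin n) (h : i < j) :
      QuantumTorusRel Q
        (FreeAlgebra.ι K (Sum.inl i) * FreeAlgebra.ι K (Sum.inl j))
        (Q i j • (FreeAlgebra.ι K (Sum.inl j) * FreeAlgebra.ι K (Sum.inl i)))
  | mul_inv (i : Fin n) :
      QuantumTorusRel Q (FreeAlgebra.ι K (Sum.inl i) * FreeAlgebra.ι K (Sum.inr i)) 1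
  | inv_mul (i : Fin n) :
      QuantumTorusRel Q (FreeAlgebra.ι K (Sum.inr i) * FreeAlgebra.ι K (Sum.inl i)) 1

/-- The quantum torus `O_Q((K^*)^n)`: the `K`-algebra generated by `x_1^{±1}, …, x_n^{±1}`
subject to `x_i x_j = q_{ij} x_j x_i` for `i < j` and `x_i x_i⁻¹ = 1 = x_i⁻¹ x_i`. -/
abbrev QuantumTorus {K : Type*} [Field K] {n : ℕ} (Q : Matrix (Fin n) (Fin n) K) : Type _ :=
  RingQuot (QuantumTorusRel Q)

/-- The canonical generator `x_i` of the quantum torus. -/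
noncomputable def QuantumTorus.x {K : Type*} [Field K] {n : ℕ} (Q : Matrix (Fin n) (Fin n) K)
    (i : Fin n) : QuantumTorus Q :=
  RingQuot.mkAlgHom K (QuantumTorusRel Q) (FreeAlgebra.ι K (Sum.inl i))

/-- A `K`-algebra automorphism of the quantum torus is toric if it multiplies each canonical
generator `x_i` by a non-zero scalar `λ_i`. -/
def IsToric {K : Type*} [Field K] {n : ℕ} {Q : Matrix (Fin n) (Fin n) K}
    (σ : QuantumTorus Q ≃ₐ[K] QuantumTorus Q) : Prop :=
  ∃ Λ : Fin n → K, (∀ i, Λ i ≠ 0) ∧ ∀ i, σ (QuantumTorus.x Q i) = Λ i • QuantumTorus.x Q i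

/-- The automorphism `σ` is inner: `σ r = s⁻¹ r s` for some unit `s`. -/
def IsInnerAut {K R : Type*} [Field K] [Ring R] [Algebra K R] (σ : R ≃ₐ[K] R) : Prop :=
  ∃ s : Rˣ, ∀ r : R, σ r = ↑s⁻¹ * r * ↑s

/-- The `K`-linear map `δ` is a (left) `σ`-derivation. -/
def IsSkewDerivation {K R : Type*} [Field K] [Ring R] [Algebra K R] (σ : R ≃ₐ[K] R)
    (δ : R →ₗ[K] R) : Prop :=
  ∀ r s : R, δ (r * s) = σ r * δ s + δ r * s

/-- The map `δ` is the inner `σ`-derivation `r ↦ a r - σ(r) a` induced by some `a`. -/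
def IsInnerSkewDerivation {K R : Type*} [Field K] [Ring R] [Algebra K R] (σ : R ≃ₐ[K] R)
    (δ : R →ₗ[K] R) : Prop :=
  ∃ a : R, ∀ r : R, δ r = a * r - σ r * a

/-- `S`, together with `ι : R → S` and `x ∈ S`, is an Ore extension `R[x; σ, δ]`: it is free as
a left `R`-module on `1, x, x², …`, and `x r = σ(r) x + δ(r)` for `r ∈ R`. -/
structure IsOreExtension {K R S : Type*} [Field K] [Ring R] [Algebra K R] [Ring S] [Algebra K S]
    (σ : R ≃ₐ[K] R) (δ : R →ₗ[K] R) (ι : R →ₐ[K] S) (x : S) : Prop where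
  basis : ∀ s : S, ∃! c : ℕ →₀ R, s = c.sum fun i r => ι r * x ^ i
  comm : ∀ r : R, x * ι r = ι (σ r) * x + ι (δ r)

/-- The division algebra `D`, together with `f : S → D`, is the quotient division algebra of `S`:
`f` is injective and every element of `D` is both a right fraction `a s⁻¹` and a left fraction
`s⁻¹ a` with `a, s ∈ S`, `s ≠ 0`. -/
structure IsQuotientDivisionAlgebra {K S D : Type*} [Field K] [Ring S] [Algebra K S]
    [DivisionRing D] [Algebra K D] (f : S →ₐ[K] D) : Prop where
  injective : Function.Injective f
  right_fraction : ∀ d : D, ∃ a s : S, s ≠ 0 ∧ d = f a * (f s)⁻¹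
  left_fraction : ∀ d : D, ∃ a s : S, s ≠ 0 ∧ d = (f s)⁻¹ * f a

/-- The defining relation `p q - q p = 1` of the first Weyl algebra, with `p` and `q` the
generators of index `0` and `1`. -/
inductive WeylRel (K : Type*) [Field K] :
    FreeAlgebra K (Fin 2) → FreeAlgebra K (Fin 2) → Prop
  | comm : WeylRel K
      (FreeAlgebra.ι K 0 * FreeAlgebra.ι K 1 - FreeAlgebra.ι K 1 * FreeAlgebra.ι K 0) 1

/-- The first Weyl algebra `A_1` over `K`. -/
abbrev WeylAlgebraOne (K : Type*) [Field K] : Type _ := RingQuot (WeylRel K)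

/-! Monomials of a quantum torus `T` commute up to scalars, form a `K`-basis, and are eigenvectors
of a toric `σ`. Write `δ(x_i) = μ_i x_i`. Applying `δ` to `x_i x_j = q_ij x_j x_i` and comparing
components at the exponent `γ` gives `(1 - ψ_j) μ_i = (1 - ψ_i) μ_j`, where `σ(x_j) x^γ = ψ_j x^γ
x_j`. If some `ψ_j ≠ 1`, an inner `σ`-derivation removes this component for all `i` at once;
otherwise `x^γ r = σ(r) x^γ` for all `r`, so `x^γ` implements `σ`. This is `exists_sub_inner`. In
particular, an outer `σ` leaves nothing and `δ` is inner.

If `δ` is induced by `a`, then `y = x - a` satisfies `y r = σ(r) y`, so `y` and the `x_i` generate a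
quantum torus in `D` whose image contains that of `S`; it therefore has the same fractions.

If `σ` is implemented by `s`, then `sδ` is an ordinary derivation, equal up to an inner one to some
`δ'` with `δ'(x_i) = z_i x_i` and `z_i` central. If `δ` is outer, some `z_i` is non-zero, and `(z_i
x_i)⁻¹ (s x - a)` and `x_i` satisfy the Weyl relation. As `A_1` is not simple in positive
characteristic, injectivity is proved by clearing denominators and comparing degrees in `x`.

The quotient division algebra exists because `S` is a domain of polynomial growth: if `Sa ∩ Sb = 0`
with `a, b ≠ 0`, the dimensions in a multiplicative filtration would double at regular steps
(`ore_of_growth`). -/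

namespace QuantumTorus

/-! ### Generators and the universal property of the quantum torus -/

section Basic

variable {K : Type*} [Field K] {n : ℕ} (Q : Matrix (Fin n) (Fin n) K)

/-- The canonical generator `x_i` as a unit. -/
noncomputable def gen (i : Fin n) : (QuantumTorus Q)ˣ where
  val := x Q i
  inv := RingQuot.mkAlgHom K (QuantumTorusRel Q) (FreeAlgebra.ι K (Sum.inr i))
  val_inv := by
    rw [x, ← map_mul, RingQuot.mkAlgHom_rel K (QuantumTorusRel.mul_inv i), map_one]
  inv_val := by
    rw [x, ← map_mul, RingQuot.mkAlgHom_rel K (QuantumTorusRel.inv_mul i), map_one]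

@[simp] theorem val_gen (i : Fin n) : (gen Q i : QuantumTorus Q) = x Q i := rfl

theorem gen_mul_gen (hQ : IsMultAntisymm Q) (i j : Fin n) :
    x Q i * x Q j = Q i j • (x Q j * x Q i) := by
  have key : ∀ i j : Fin n, i < j → x Q i * x Q j = Q i j • (x Q j * x Q i) := fun i j h => by
    rw [x, x, ← map_mul, RingQuot.mkAlgHom_rel K (QuantumTorusRel.comm i j h), map_smul, map_mul]
  rcases lt_trichotomy i j with h | rfl | h
  · exact key i j h
  · rw [hQ.diag, one_smul]
  · rw [key j i h, smul_smul, hQ.inv j i, inv_mul_cancel₀ (hQ.ne_zero j i), one_smul]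

theorem adjoin_eq_top :
    Algebra.adjoin K (Set.range (x Q) ∪ Set.range fun i => (↑(gen Q i)⁻¹ : QuantumTorus Q)) = ⊤ := by
  have h := congrArg (Subalgebra.map (RingQuot.mkAlgHom K (QuantumTorusRel Q)))
    (FreeAlgebra.adjoin_range_ι K (Fin n ⊕ Fin n))
  rw [AlgHom.map_adjoin, Algebra.map_top,
    (AlgHom.range_eq_top _).2 (RingQuot.mkAlgHom_surjective K (QuantumTorusRel Q)),
    Sum.range_eq, Set.image_union, ← Set.range_comp, ← Set.range_comp] at h
  exact h

variable {Q}

@[elab_as_elim]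
theorem induction {P : QuantumTorus Q → Prop} (algebraMap : ∀ c, P (algebraMap K _ c))
    (add : ∀ a b, P a → P b → P (a + b)) (mul : ∀ a b, P a → P b → P (a * b))
    (gen : ∀ i, P (x Q i)) (gen_inv : ∀ i, P ↑(QuantumTorus.gen Q i)⁻¹) (a : QuantumTorus Q) : P a := by
  have ha : a ∈ Algebra.adjoin K
      (Set.range (x Q) ∪ Set.range fun i => (↑(QuantumTorus.gen Q i)⁻¹ : QuantumTorus Q)) := by
    rw [adjoin_eq_top]; trivial
  induction ha using Algebra.adjoin_induction with
  | mem a ha =>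
    rcases ha with ⟨i, rfl⟩ | ⟨i, rfl⟩
    · exact gen i
    · exact gen_inv i
  | algebraMap c => exact algebraMap c
  | add a b _ _ iha ihb => exact add a b iha ihb
  | mul a b _ _ iha ihb => exact mul a b iha ihb

/-- The relation `b f(a) = g(a) b` is stable in `a` under sums, products and inverses of units. -/
theorem semiconjBy_of_gen {B : Type*} [Ring B] [Algebra K B] {f g : QuantumTorus Q →ₐ[K] B} {b : B}
    (h : ∀ i, SemiconjBy b (f (x Q i)) (g (x Q i))) (a : QuantumTorus Q) :
    SemiconjBy b (f a) (g a) := by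
  induction a using induction with
  | algebraMap c =>
    simp only [AlgHom.commutes]
    exact (Algebra.commutes c b).symm
  | add a a' ha ha' => simpa using ha.add_right ha'
  | mul a a' ha ha' => simpa using ha.mul_right ha'
  | gen i => exact h i
  | gen_inv i =>
    have : SemiconjBy b ↑(Units.map (f : QuantumTorus Q →* B) (gen Q i))
      ↑(Units.map (g : QuantumTorus Q →* B) (gen Q i)) := h i
    simpa [← map_inv] using this.units_inv_right

/-- The universal property of the quantum torus. -/
noncomputable def lift {B : Type*} [Ring B] [Algebra K B] (u : Fin n → Bˣ)
    (h : ∀ i j, i < j → (u i * u j : B) = Q i j • (u j * u i : B)) : QuantumTorus Q →ₐ[K] B :=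
  RingQuot.liftAlgHom K ⟨FreeAlgebra.lift K (Sum.elim (fun i => (u i : B)) fun i => ↑(u i)⁻¹), by
    rintro _ _ (⟨i, j, hij⟩ | i | i)
    · simpa using h i j hij
    · simp
    · simp⟩

@[simp] theorem lift_x {B : Type*} [Ring B] [Algebra K B] (u : Fin n → Bˣ)
    (h : ∀ i j, i < j → (u i * u j : B) = Q i j • (u j * u i : B)) (i : Fin n) :
    lift u h (x Q i) = u i := by
  rw [lift, x, RingQuot.liftAlgHom_mkAlgHom_apply]; simp

end Basic

/-! ### The monomial basis -/

section Monomials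

variable {K : Type*} [Field K] {n : ℕ} (Q : Matrix (Fin n) (Fin n) K)

/-- The central subgroup of non-zero scalars in the unit group of the quantum torus. -/
noncomputable def scalarUnits : Subgroup (QuantumTorus Q)ˣ :=
  (Units.map (algebraMap K (QuantumTorus Q) : K →* QuantumTorus Q)).range

instance : (scalarUnits Q).Normal where
  conj_mem := by
    rintro _ ⟨c, rfl⟩ g
    refine ⟨c, ?_⟩
    ext
    simp [← Algebra.commutes]

variable {Q}

/-- Identities between monomials up to a scalar thus become exact identities in a quotient group
where the generators commute. -/
theorem mk_eq_mk_iff {u v : (QuantumTorus Q)ˣ} :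
    (u : (QuantumTorus Q)ˣ ⧸ scalarUnits Q) = v ↔
      ∃ c : K, c ≠ 0 ∧ (v : QuantumTorus Q) = c • (u : QuantumTorus Q) := by
  rw [QuotientGroup.eq]
  constructor
  · rintro ⟨c, hc⟩
    refine ⟨c, c.ne_zero, ?_⟩
    rw [Algebra.smul_def, Algebra.commutes]
    have := congrArg (fun w => (↑(u * w) : QuantumTorus Q)) hc
    simpa using this.symm
  · rintro ⟨c, hc, h⟩
    refine ⟨Units.mk0 c hc, ?_⟩
    ext
    simp [h, Algebra.algebraMap_eq_smul_one]

theorem commute_mk_gen (hQ : IsMultAntisymm Q) (i j : Fin n) :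
    Commute (gen Q i : (QuantumTorus Q)ˣ ⧸ scalarUnits Q) (gen Q j) := by
  change ((gen Q i * gen Q j : (QuantumTorus Q)ˣ) : (QuantumTorus Q)ˣ ⧸ scalarUnits Q) =
    (gen Q j * gen Q i : (QuantumTorus Q)ˣ)
  rw [mk_eq_mk_iff]
  exact ⟨Q j i, hQ.ne_zero j i, gen_mul_gen Q hQ j i⟩

theorem pairwise_commute_zpowersHom (hQ : IsMultAntisymm Q) :
    Pairwise fun i j => ∀ a b : Multiplicative ℤ,
      Commute (zpowersHom _ (gen Q i : (QuantumTorus Q)ˣ ⧸ scalarUnits Q) a)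
        (zpowersHom _ (gen Q j : (QuantumTorus Q)ˣ ⧸ scalarUnits Q) b) :=
  fun i j _ a b => by
    simpa only [zpowersHom_apply] using (commute_mk_gen hQ i j).zpow_zpow _ _

/-- The class of the monomial with a given exponent, modulo scalars. -/
noncomputable def monomialClass (hQ : IsMultAntisymm Q) :
    (Fin n → Multiplicative ℤ) →* (QuantumTorus Q)ˣ ⧸ scalarUnits Q :=
  MonoidHom.noncommPiCoprod (fun i => zpowersHom _ (gen Q i : (QuantumTorus Q)ˣ ⧸ scalarUnits Q))
    (pairwise_commute_zpowersHom hQ)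

/-- A monomial of exponent `α`; it is only normalised up to a non-zero scalar. -/
noncomputable def monomial (hQ : IsMultAntisymm Q) (α : Fin n → ℤ) : (QuantumTorus Q)ˣ :=
  (monomialClass hQ fun i => Multiplicative.ofAdd (α i)).out

theorem mk_monomial (hQ : IsMultAntisymm Q) (α : Fin n → ℤ) :
    (monomial hQ α : (QuantumTorus Q)ˣ ⧸ scalarUnits Q) =
      monomialClass hQ fun i => Multiplicative.ofAdd (α i) :=
  Quotient.out_eq' _

theorem monomial_add (hQ : IsMultAntisymm Q) (α β : Fin n → ℤ) :
    ∃ c : K, c ≠ 0 ∧ (monomial hQ (α + β) : QuantumTorus Q) =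
      c • (monomial hQ α * monomial hQ β : QuantumTorus Q) := by
  rw [← Units.val_mul, ← mk_eq_mk_iff, QuotientGroup.mk_mul, mk_monomial, mk_monomial,
    mk_monomial, ← map_mul]
  rfl

theorem monomial_mul (hQ : IsMultAntisymm Q) (α β : Fin n → ℤ) :
    ∃ c : K, c ≠ 0 ∧ (monomial hQ α * monomial hQ β : QuantumTorus Q) =
      c • (monomial hQ (α + β) : QuantumTorus Q) := by
  obtain ⟨c, hc, h⟩ := monomial_add hQ α β
  exact ⟨c⁻¹, inv_ne_zero hc, by rw [h, inv_smul_smul₀ hc]⟩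

theorem monomial_zero (hQ : IsMultAntisymm Q) :
    ∃ c : K, c ≠ 0 ∧ (monomial hQ 0 : QuantumTorus Q) = c • 1 := by
  rw [← Units.val_one, ← mk_eq_mk_iff, mk_monomial, QuotientGroup.mk_one]
  exact (map_one (monomialClass hQ)).symm

theorem monomial_neg (hQ : IsMultAntisymm Q) (α : Fin n → ℤ) :
    ∃ c : K, c ≠ 0 ∧ (monomial hQ (-α) : QuantumTorus Q) =
      c • (↑(monomial hQ α)⁻¹ : QuantumTorus Q) := by
  rw [← mk_eq_mk_iff, QuotientGroup.mk_inv, mk_monomial, mk_monomial, ← map_inv]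
  rfl

theorem monomial_single (hQ : IsMultAntisymm Q) (i : Fin n) :
    ∃ c : K, c ≠ 0 ∧ (monomial hQ (Pi.single i 1) : QuantumTorus Q) = c • x Q i := by
  rw [← val_gen, ← mk_eq_mk_iff, mk_monomial]
  have : (fun j => Multiplicative.ofAdd ((Pi.single i 1 : Fin n → ℤ) j)) =
      Pi.mulSingle i (Multiplicative.ofAdd 1) := by
    ext j
    rcases eq_or_ne j i with rfl | h
    · simp
    · simp [h]
  rw [this, monomialClass, MonoidHom.noncommPiCoprod_mulSingle]
  simp

theorem monomial_neg_single (hQ : IsMultAntisymm Q) (i : Fin n) :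
    ∃ c : K, c ≠ 0 ∧ (monomial hQ (-Pi.single i 1) : QuantumTorus Q) =
      c • (↑(gen Q i)⁻¹ : QuantumTorus Q) := by
  have h : (gen Q i : (QuantumTorus Q)ˣ ⧸ scalarUnits Q) = monomial hQ (Pi.single i 1) :=
    mk_eq_mk_iff.2 (monomial_single hQ i)
  have h' : (↑(monomial hQ (Pi.single i 1))⁻¹ : (QuantumTorus Q)ˣ ⧸ scalarUnits Q) =
      monomial hQ (-Pi.single i 1) := mk_eq_mk_iff.2 (monomial_neg hQ _)
  rw [← mk_eq_mk_iff, QuotientGroup.mk_inv, h, ← h', QuotientGroup.mk_inv]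

/-- A property of pairs (exponent, unit) that is compatible with the group operations and with
non-zero scalars holds for all monomials if it holds for the generators. -/
theorem monomial_induction (hQ : IsMultAntisymm Q)
    {P : (Fin n → ℤ) → (QuantumTorus Q)ˣ → Prop}
    (smul : ∀ (c : K) (α) (u v : (QuantumTorus Q)ˣ), c ≠ 0 →
      (v : QuantumTorus Q) = c • (u : QuantumTorus Q) → P α u → P α v)
    (one : P 0 1) (mul : ∀ α β u v, P α u → P β v → P (α + β) (u * v))
    (inv : ∀ α u, P α u → P (-α) u⁻¹) (gen : ∀ i, P (Pi.single i 1) (gen Q i))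
    (α : Fin n → ℤ) : P α (monomial hQ α) := by
  -- The good exponents form a subgroup of `ℤⁿ`, so it suffices that it contains the standard basis.
  let H : AddSubgroup (Fin n → ℤ) :=
    { carrier := {α | P α (monomial hQ α)}
      zero_mem' := by
        obtain ⟨c, hc, h⟩ := monomial_zero hQ
        exact smul c _ 1 _ hc h one
      add_mem' := fun {α β} hα hβ => by
        obtain ⟨c, hc, h⟩ := monomial_add hQ α β
        exact smul c _ (_ * _) _ hc h (mul _ _ _ _ hα hβ)
      neg_mem' := fun {α} hα => by
        obtain ⟨c, hc, h⟩ := monomial_neg hQ α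
        exact smul c _ _⁻¹ _ hc h (inv _ _ hα) }
  change α ∈ H
  rw [pi_eq_sum_univ' α]
  refine H.sum_mem fun i _ => H.zsmul_mem ?_ _
  obtain ⟨c, hc, h⟩ := monomial_single hQ i
  exact smul c _ (QuantumTorus.gen Q i) _ hc h (gen i)

/-- The structure constants of the action of the quantum torus on functions on `ℤⁿ`. -/
noncomputable def weight (Q : Matrix (Fin n) (Fin n) K) (j : Fin n) (β : Fin n → ℤ) : K :=
  ∏ k ∈ Finset.univ.filter (· < j), Q k j ^ β k

theorem weight_ne_zero (hQ : IsMultAntisymm Q) (j : Fin n) (β : Fin n → ℤ) : weight Q j β ≠ 0 :=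
  Finset.prod_ne_zero_iff.2 fun k _ => zpow_ne_zero _ (hQ.ne_zero k j)

/-- The weight of `j` sees only the coordinates below `j`. This asymmetry makes the weighted shifts
satisfy the defining relations: for `i < j`, exactly one of the two orders picks up `Q i j`. -/
theorem weight_add_single (hQ : IsMultAntisymm Q) (j i : Fin n) (β : Fin n → ℤ) :
    weight Q j (β + Pi.single i 1) = (if i < j then Q i j else 1) * weight Q j β := by
  have : ∀ k, Q k j ^ (β + Pi.single i 1 : Fin n → ℤ) k = (if k = i then Q k j else 1) * Q k j ^ β k := by
    intro k
    rcases eq_or_ne k i with rfl | h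
    · simp [zpow_add₀ (hQ.ne_zero k j), mul_comm]
    · simp [h]
  simp_rw [weight, this, Finset.prod_mul_distrib]
  congr 1
  rw [Finset.prod_ite_eq' (Finset.univ.filter (· < j)) i fun k => Q k j]
  simp

/-- The generator `x_i` acts on functions on `ℤⁿ` by a weighted shift. -/
noncomputable def shift (hQ : IsMultAntisymm Q) (i : Fin n) :
    (Module.End K ((Fin n → ℤ) → K))ˣ where
  val :=
    { toFun := fun f β => weight Q i β * f (β + Pi.single i 1)
      map_add' := fun f g => by ext; simp [mul_add]
      map_smul' := fun c f => by ext; simp [mul_left_comm] }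
  inv :=
    { toFun := fun f β => (weight Q i (β - Pi.single i 1))⁻¹ * f (β - Pi.single i 1)
      map_add' := fun f g => by ext; simp [mul_add]
      map_smul' := fun c f => by ext; simp [mul_left_comm] }
  val_inv := by
    ext1 f; ext β
    simp [weight_ne_zero hQ]
  inv_val := by
    ext1 f; ext β
    simp [weight_ne_zero hQ]

theorem shift_apply (hQ : IsMultAntisymm Q) (i : Fin n) (f : (Fin n → ℤ) → K) (β : Fin n → ℤ) :
    (shift hQ i : Module.End K ((Fin n → ℤ) → K)) f β = weight Q i β * f (β + Pi.single i 1) := rfl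

/-- The action of the quantum torus on functions on `ℤⁿ`. -/
noncomputable def shiftRep (hQ : IsMultAntisymm Q) :
    QuantumTorus Q →ₐ[K] Module.End K ((Fin n → ℤ) → K) :=
  lift (shift hQ) fun i j hij => by
    ext1 f; ext β
    simp only [Module.End.mul_apply, LinearMap.smul_apply, Pi.smul_apply, shift_apply,
      weight_add_single hQ, if_pos hij, if_neg hij.not_gt, add_right_comm β (Pi.single i 1),
      smul_eq_mul]
    ring

theorem shiftRep_monomial (hQ : IsMultAntisymm Q) (α : Fin n → ℤ) :
    ∃ c : (Fin n → ℤ) → K, (∀ β, c β ≠ 0) ∧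
      ∀ f β, shiftRep hQ (monomial hQ α) f β = c β * f (β + α) := by
  refine monomial_induction hQ (P := fun α u => ∃ c : (Fin n → ℤ) → K, (∀ β, c β ≠ 0) ∧
      ∀ f β, shiftRep hQ u f β = c β * f (β + α)) ?_ ?_ ?_ ?_ ?_ α
  · rintro c α u v hc h ⟨d, hd, hu⟩
    refine ⟨fun β => c * d β, fun β => mul_ne_zero hc (hd β), fun f β => ?_⟩
    simp [h, hu, mul_assoc]
  · exact ⟨1, by simp, by simp⟩
  · rintro α β u v ⟨c, hc, hu⟩ ⟨d, hd, hv⟩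
    refine ⟨fun γ => c γ * d (γ + α), fun γ => mul_ne_zero (hc _) (hd _), fun f γ => ?_⟩
    simp [hu, hv, mul_assoc, add_assoc]
  · rintro α u ⟨c, hc, hu⟩
    refine ⟨fun γ => (c (γ - α))⁻¹, fun γ => inv_ne_zero (hc _), fun f γ => ?_⟩
    have h1 : shiftRep hQ u (shiftRep hQ ↑u⁻¹ f) = f := by
      rw [← Module.End.mul_apply, ← map_mul]; simp
    have h2 := congrFun h1 (γ - α)
    rw [hu, sub_add_cancel] at h2
    rw [eq_inv_mul_iff_mul_eq₀ (hc _), h2, sub_eq_add_neg]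
  · intro i
    refine ⟨weight Q i, weight_ne_zero hQ i, fun f β => ?_⟩
    rw [val_gen, shiftRep, lift_x, shift_apply]

/-- In the shift representation, a monomial of exponent `β` applied to the indicator function of `γ`
and evaluated at `0` is non-zero exactly when `β = γ`, so this functional isolates the coefficient
of `γ`. -/
theorem linearIndependent_monomial (hQ : IsMultAntisymm Q) :
    LinearIndependent K fun α => (monomial hQ α : QuantumTorus Q) := by
  classical
  rw [linearIndependent_iff]
  intro l hl
  ext γ
  obtain ⟨c, hc⟩ := Classical.axiom_of_choice (shiftRep_monomial hQ)
  have h := congrFun (congrArg (fun a => shiftRep hQ a (Pi.single γ 1)) hl) 0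
  simp only [Finsupp.linearCombination_apply, Finsupp.sum, map_sum, map_smul,
    LinearMap.sum_apply, LinearMap.smul_apply, Finset.sum_apply, Pi.smul_apply, (hc _).2,
    zero_add, map_zero, LinearMap.zero_apply, Pi.zero_apply, smul_eq_mul] at h
  rw [Finset.sum_eq_single γ] at h
  · simpa [(hc γ).1] using h
  · intro β _ hβ
    simp [Pi.single_eq_of_ne hβ]
  · intro h'
    simp [Finsupp.notMem_support_iff.1 h']

/-- The span is closed under products because a product of monomials is a scalar multiple of a
monomial. -/
theorem span_monomial (hQ : IsMultAntisymm Q) :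
    ⊤ ≤ Submodule.span K (Set.range fun α => (monomial hQ α : QuantumTorus Q)) := by
  set W := Submodule.span K (Set.range fun α => (monomial hQ α : QuantumTorus Q)) with hW
  have hmem : ∀ α, (monomial hQ α : QuantumTorus Q) ∈ W := fun α => Submodule.subset_span ⟨α, rfl⟩
  have hmul : ∀ a b, a ∈ W → b ∈ W → a * b ∈ W := by
    have : W * W ≤ W := by
      conv_lhs => rw [hW, Submodule.span_mul_span]
      rw [Submodule.span_le]
      rintro _ ⟨_, ⟨α, rfl⟩, _, ⟨β, rfl⟩, rfl⟩
      obtain ⟨c, -, h⟩ := monomial_mul hQ α β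
      change (monomial hQ α * monomial hQ β : QuantumTorus Q) ∈ W
      rw [h]
      exact W.smul_mem _ (hmem _)
    exact fun a b ha hb => this (Submodule.mul_mem_mul ha hb)
  intro a _
  induction a using induction with
  | algebraMap c =>
    obtain ⟨d, hd, h⟩ := monomial_zero hQ
    have := W.smul_mem (c * d⁻¹) (hmem 0)
    rwa [h, smul_smul, inv_mul_cancel_right₀ hd, ← Algebra.algebraMap_eq_smul_one] at this
  | add a b ha hb => exact W.add_mem (ha trivial) (hb trivial)
  | mul a b ha hb => exact hmul a b (ha trivial) (hb trivial)
  | gen i =>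
    obtain ⟨c, hc, h⟩ := monomial_single hQ i
    rw [← inv_smul_smul₀ hc (x Q i), ← h]
    exact W.smul_mem _ (hmem _)
  | gen_inv i =>
    obtain ⟨c, hc, h⟩ := monomial_neg_single hQ i
    rw [← inv_smul_smul₀ hc (↑(gen Q i)⁻¹ : QuantumTorus Q), ← h]
    exact W.smul_mem _ (hmem _)

/-- The monomials form a basis of the quantum torus. -/
noncomputable def basis (hQ : IsMultAntisymm Q) :
    Module.Basis (Fin n → ℤ) K (QuantumTorus Q) :=
  .mk (linearIndependent_monomial hQ) (span_monomial hQ)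

@[simp] theorem basis_apply (hQ : IsMultAntisymm Q) (α : Fin n → ℤ) :
    basis hQ α = monomial hQ α := by simp [basis]

end Monomials

end QuantumTorus

/-! ### Skew derivations of a general algebra -/

section SkewDerivation

variable {K R : Type*} [Field K] [Ring R] [Algebra K R]

/-- The inner `σ`-derivation `r ↦ a r - σ(r) a`. -/
noncomputable def innerSkewDerivation (σ : R ≃ₐ[K] R) (a : R) : R →ₗ[K] R :=
  LinearMap.mulLeft K a - LinearMap.mulRight K a ∘ₗ σ.toLinearMap

@[simp] theorem innerSkewDerivation_apply (σ : R ≃ₐ[K] R) (a r : R) :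
    innerSkewDerivation σ a r = a * r - σ r * a := rfl

theorem IsSkewDerivation.sub_inner {σ : R ≃ₐ[K] R} {δ : R →ₗ[K] R} (hδ : IsSkewDerivation σ δ)
    (a : R) : IsSkewDerivation σ (δ - innerSkewDerivation σ a) := fun r s => by
  simp only [LinearMap.sub_apply, hδ r s, innerSkewDerivation_apply, map_mul]
  noncomm_ring

theorem IsSkewDerivation.map_one {σ : R ≃ₐ[K] R} {δ : R →ₗ[K] R} (hδ : IsSkewDerivation σ δ) :
    δ 1 = 0 := by
  simpa using hδ 1 1

/-- Apply `δ` to `u⁻¹ u = 1`. -/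
theorem IsSkewDerivation.map_units_inv {σ : R ≃ₐ[K] R} {δ : R →ₗ[K] R}
    (hδ : IsSkewDerivation σ δ) (u : Rˣ) : δ ↑u⁻¹ = -(σ ↑u⁻¹ * δ u * ↑u⁻¹) := by
  have h := hδ ↑u⁻¹ u
  rw [Units.inv_mul, hδ.map_one] at h
  have h' := congrArg (· * (↑u⁻¹ : R)) h
  simp only [zero_mul, add_mul, mul_assoc, Units.mul_inv, mul_one] at h'
  rw [mul_assoc]
  exact (neg_eq_of_add_eq_zero_right h'.symm).symm

end SkewDerivation

/-! ### Skew derivations of the quantum torus -/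

namespace QuantumTorus

variable {K : Type*} [Field K] {n : ℕ} {Q : Matrix (Fin n) (Fin n) K}

theorem skewDerivation_eq_zero {σ : QuantumTorus Q ≃ₐ[K] QuantumTorus Q}
    {δ : QuantumTorus Q →ₗ[K] QuantumTorus Q} (hδ : IsSkewDerivation σ δ)
    (h : ∀ i, δ (x Q i) = 0) (a : QuantumTorus Q) : δ a = 0 := by
  induction a using induction with
  | algebraMap c => rw [Algebra.algebraMap_eq_smul_one, map_smul, hδ.map_one, smul_zero]
  | add a b ha hb => rw [map_add, ha, hb, add_zero]
  | mul a b ha hb => rw [hδ, ha, hb, mul_zero, zero_mul, add_zero]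
  | gen i => exact h i
  | gen_inv i => rw [hδ.map_units_inv, val_gen, h]; simp

theorem monomial_commute (hQ : IsMultAntisymm Q) (α β : Fin n → ℤ) :
    ∃ c : K, c ≠ 0 ∧ (monomial hQ α * monomial hQ β : QuantumTorus Q) =
      c • (monomial hQ β * monomial hQ α : QuantumTorus Q) := by
  obtain ⟨c, hc, h⟩ := monomial_mul hQ α β
  obtain ⟨d, hd, h'⟩ := monomial_add hQ β α
  exact ⟨c * d, mul_ne_zero hc hd, by rw [h, add_comm, h', smul_smul]⟩

theorem x_mul_monomial (hQ : IsMultAntisymm Q) (i : Fin n) (β : Fin n → ℤ) :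
    ∃ c : K, c ≠ 0 ∧ (x Q i * monomial hQ β : QuantumTorus Q) =
      c • (monomial hQ β * x Q i : QuantumTorus Q) := by
  obtain ⟨c, hc, h⟩ := monomial_single hQ i
  obtain ⟨d, hd, h'⟩ := monomial_commute hQ (Pi.single i 1) β
  refine ⟨d, hd, ?_⟩
  rw [h, smul_mul_assoc, mul_smul_comm, smul_comm d c] at h'
  exact smul_right_injective _ hc h'

theorem nontrivial (hQ : IsMultAntisymm Q) : Nontrivial (QuantumTorus Q) :=
  ⟨_, _, (basis hQ).ne_zero 0⟩

/-- The group `ℤⁿ` has unique sums: some exponent of `a b` arises from a single pair of support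
elements, and its coefficient cannot cancel. -/
theorem noZeroDivisors (hQ : IsMultAntisymm Q) : NoZeroDivisors (QuantumTorus Q) where
  eq_zero_or_eq_zero_of_mul_eq_zero := by
    classical
    intro a b hab
    by_contra! h
    set e := basis hQ with he
    have hA : (e.repr a).support.Nonempty := by simpa [Finsupp.support_nonempty_iff] using h.1
    have hB : (e.repr b).support.Nonempty := by simpa [Finsupp.support_nonempty_iff] using h.2
    obtain ⟨α, hα, β, hβ, hu⟩ := UniqueSums.uniqueAdd_of_nonempty hA hB
    choose κ hκ hmul using fun α : Fin n → ℤ => fun β : Fin n → ℤ => monomial_mul hQ α β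
    have hsum : a * b = ∑ γ ∈ (e.repr a).support, ∑ γ' ∈ (e.repr b).support,
        (e.repr a γ * e.repr b γ' * κ γ γ') • e (γ + γ') := by
      conv_lhs => rw [← e.linearCombination_repr a, ← e.linearCombination_repr b,
        Finsupp.linearCombination_apply, Finsupp.linearCombination_apply, Finsupp.sum, Finsupp.sum,
        Finset.sum_mul_sum]
      refine Finset.sum_congr rfl fun γ _ => Finset.sum_congr rfl fun γ' _ => ?_
      rw [smul_mul_smul_comm, he, basis_apply, basis_apply, basis_apply, hmul, smul_smul]
    have h0 := congrArg (fun r => e.repr r (α + β)) hsum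
    simp only [hab, map_zero, Finsupp.zero_apply, map_sum, map_smul, Module.Basis.repr_self,
      Finsupp.finsetSum_apply, Finsupp.smul_apply, smul_eq_mul, Finsupp.single_apply] at h0
    rw [Finset.sum_eq_single_of_mem α hα, Finset.sum_eq_single_of_mem β hβ, if_pos rfl] at h0
    · rw [Finsupp.mem_support_iff] at hα hβ
      simp [hα, hβ, hκ] at h0
    · intro γ hγ hne
      rw [if_neg, mul_zero]
      exact fun h' => hne (hu hα hγ h').2
    · intro γ hγ hne
      refine Finset.sum_eq_zero fun γ' hγ' => ?_
      rw [if_neg, mul_zero]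
      exact fun h' => hne (hu hγ hγ' h').1

theorem _root_.IsToric.map_monomial {σ : QuantumTorus Q ≃ₐ[K] QuantumTorus Q} (hσ : IsToric σ)
    (hQ : IsMultAntisymm Q) (α : Fin n → ℤ) :
    ∃ c : K, c ≠ 0 ∧ σ (monomial hQ α) = c • (monomial hQ α : QuantumTorus Q) := by
  obtain ⟨Λ, hΛ, hx⟩ := hσ
  refine monomial_induction hQ
    (P := fun _ u => ∃ c : K, c ≠ 0 ∧ σ u = c • (u : QuantumTorus Q)) ?_ ?_ ?_ ?_ ?_ α
  · rintro c - u v - h ⟨d, hd, hu⟩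
    exact ⟨d, hd, by rw [h, map_smul, hu, smul_comm]⟩
  · exact ⟨1, one_ne_zero, by simp⟩
  · rintro - - u v ⟨c, hc, hu⟩ ⟨d, hd, hv⟩
    exact ⟨c * d, mul_ne_zero hc hd, by
      rw [Units.val_mul, map_mul, hu, hv, smul_mul_smul_comm]⟩
  · rintro - u ⟨c, hc, hu⟩
    refine ⟨c⁻¹, inv_ne_zero hc, ?_⟩
    have h : (c⁻¹ • (↑u⁻¹ : QuantumTorus Q)) * σ u = 1 := by
      rw [hu, smul_mul_smul_comm, inv_mul_cancel₀ hc, Units.inv_mul, one_smul]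
    have h' : σ u * σ ↑u⁻¹ = 1 := by rw [← map_mul, Units.mul_inv, map_one]
    exact (left_inv_eq_right_inv h h').symm
  · exact fun i => ⟨Λ i, hΛ i, hx i⟩

theorem repr_of_diagonal (hQ : IsMultAntisymm Q) {L : QuantumTorus Q →ₗ[K] QuantumTorus Q}
    {ψ : (Fin n → ℤ) → K}
    (h : ∀ γ, L (monomial hQ γ) = ψ γ • (monomial hQ γ : QuantumTorus Q)) (r : QuantumTorus Q)
    (γ : Fin n → ℤ) : (basis hQ).repr (L r) γ = ψ γ * (basis hQ).repr r γ := by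
  have : (basis hQ).coord γ ∘ₗ L = ψ γ • (basis hQ).coord γ := by
    refine (basis hQ).ext fun β => ?_
    simp only [LinearMap.comp_apply, basis_apply, h, LinearMap.smul_apply, map_smul]
    rw [← basis_apply, Module.Basis.coord_apply, Module.Basis.repr_self]
    rcases eq_or_ne β γ with rfl | hne
    · rfl
    · simp [hne]
  exact LinearMap.congr_fun this r

/-- Up to an inner `σ`-derivation, a `σ`-derivation `δ` of a quantum torus only has components
that are multiples of monomials inducing `σ`. -/
theorem exists_sub_inner (hQ : IsMultAntisymm Q) {σ : QuantumTorus Q ≃ₐ[K] QuantumTorus Q}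
    (hσ : IsToric σ) {δ : QuantumTorus Q →ₗ[K] QuantumTorus Q} (hδ : IsSkewDerivation σ δ) :
    ∃ (a : QuantumTorus Q) (m : Fin n → QuantumTorus Q),
      (∀ i, δ (x Q i) - (a * x Q i - σ (x Q i) * a) = m i * x Q i) ∧
      ∀ i γ, (basis hQ).repr (m i) γ ≠ 0 →
        ∀ r, SemiconjBy (monomial hQ γ : QuantumTorus Q) r (σ r) := by
  classical
  obtain ⟨Λ, hΛ, hx⟩ := id hσ
  set e := basis hQ with he
  choose c hc hxc using x_mul_monomial hQ
  -- The twisted conjugation `r ↦ σ(x_i) r x_i⁻¹`, diagonal on monomials with eigenvalues `ψ i`;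
  -- subtracting the inner derivation of `a` changes `μ i` by `a - Ψ i a`.
  let Ψ : Fin n → QuantumTorus Q →ₗ[K] QuantumTorus Q := fun i =>
    LinearMap.mulRight K ↑(gen Q i)⁻¹ ∘ₗ LinearMap.mulLeft K (σ (x Q i))
  let ψ : Fin n → (Fin n → ℤ) → K := fun i γ => Λ i * c i γ
  have hΨx : ∀ i r, Ψ i r * x Q i = σ (x Q i) * r := fun i r => by
    simp only [Ψ, LinearMap.comp_apply, LinearMap.mulRight_apply, LinearMap.mulLeft_apply]
    rw [← val_gen, Units.inv_mul_cancel_right]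
  have hcancel : ∀ i (a b : QuantumTorus Q), a * x Q i = b * x Q i → a = b := fun i a b h =>
    (gen Q i).isUnit.mul_left_injective h
  have hψ : ∀ i γ, σ (x Q i) * monomial hQ γ =
      ψ i γ • (monomial hQ γ * x Q i : QuantumTorus Q) := fun i γ => by
    rw [hx, smul_mul_assoc, hxc, smul_smul]
  have hdiag : ∀ i r γ, e.repr (Ψ i r) γ = ψ i γ * e.repr r γ := fun i =>
    repr_of_diagonal hQ fun γ => hcancel i _ _ (by rw [hΨx, hψ, smul_mul_assoc])
  let μ : Fin n → QuantumTorus Q := fun i => δ (x Q i) * ↑(gen Q i)⁻¹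
  have hμ : ∀ i, δ (x Q i) = μ i * x Q i := fun i => by
    rw [← val_gen, Units.inv_mul_cancel_right, val_gen]
  -- Apply `δ` to `x_i x_j = q_ij x_j x_i` and cancel the unit `x_i x_j`.
  have hcomm : ∀ i j, Ψ i (μ j) + μ i = Ψ j (μ i) + μ j := fun i j => by
    have h1 : ∀ i j, δ (x Q i * x Q j) = (Ψ i (μ j) + μ i) * (x Q i * x Q j) := fun i j => by
      rw [hδ, hμ j, hμ i, ← mul_assoc (σ _), ← hΨx, add_mul]
      simp only [mul_assoc]
    have h2 := congrArg δ (gen_mul_gen Q hQ i j)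
    rw [map_smul, h1, h1, ← mul_smul_comm, ← gen_mul_gen Q hQ] at h2
    exact (gen Q i * gen Q j).isUnit.mul_left_injective h2
  have hcoord : ∀ i j γ, (1 - ψ j γ) * e.repr (μ i) γ = (1 - ψ i γ) * e.repr (μ j) γ :=
    fun i j γ => by
      have := congrArg (fun r => e.repr r γ) (hcomm i j)
      simp only [map_add, Finsupp.add_apply, hdiag] at this
      linear_combination this
  -- By `hcoord` the quotient does not depend on the chosen `j`, so one coefficient serves every
  -- `i`. The default `0` is taken where all `ψ j γ = 1`, the components that stay in `m`.
  let k : (Fin n → ℤ) → K := fun γ =>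
    if h : ∃ j, ψ j γ ≠ 1 then e.repr (μ h.choose) γ / (1 - ψ h.choose γ) else 0
  let a := e.repr.symm (Finsupp.onFinset (Finset.univ.biUnion fun j => (e.repr (μ j)).support) k
    fun γ hγ => by
      by_cases h : ∃ j, ψ j γ ≠ 1
      · simp only [k, dif_pos h] at hγ
        exact Finset.mem_biUnion.2
          ⟨h.choose, Finset.mem_univ _, Finsupp.mem_support_iff.2 (div_ne_zero_iff.1 hγ).1⟩
      · simp only [k, dif_neg h] at hγ
        exact absurd rfl hγ)
  have ha : ∀ γ, e.repr a γ = k γ := fun γ => by simp [a]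
  refine ⟨a, fun i => μ i - (a - Ψ i a), fun i => ?_, fun i γ hγ => ?_⟩
  · rw [hμ, sub_mul, sub_mul, hΨx]
  · simp only [map_sub, Finsupp.sub_apply, hdiag, ha] at hγ
    have hall : ∀ j, ψ j γ = 1 := by
      by_contra! h
      apply hγ
      have hne : 1 - ψ h.choose γ ≠ 0 := sub_ne_zero.2 h.choose_spec.symm
      have := hcoord i h.choose γ
      simp only [k, dif_pos h]
      field_simp
      linear_combination this
    intro r
    refine semiconjBy_of_gen (f := AlgHom.id K _) (g := (σ : QuantumTorus Q →ₐ[K] QuantumTorus Q))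
      (fun j => ?_) r
    have := hψ j γ
    rw [hall, one_smul] at this
    exact this.symm

/-- The span of the monomials whose exponents lie in the box of radius `d` around `α`. -/
noncomputable def box (hQ : IsMultAntisymm Q) (α : Fin n → ℤ) (d : ℕ) :
    Submodule K (QuantumTorus Q) :=
  Submodule.span K ((fun γ => (monomial hQ γ : QuantumTorus Q)) '' {γ | ∀ i, |γ i - α i| ≤ d})

theorem mul_box_zero (hQ : IsMultAntisymm Q) (d : ℕ) {u v : (QuantumTorus Q)}
    (h : ∀ γ, ∃ c : K, u * monomial hQ γ * v = c • (monomial hQ γ : QuantumTorus Q))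
    {m : QuantumTorus Q} (hm : m ∈ box hQ 0 d) : u * m * v ∈ box hQ 0 d := by
  induction hm using Submodule.span_induction with
  | mem m hm =>
    obtain ⟨γ, hγ, rfl⟩ := hm
    obtain ⟨c, hc⟩ := h γ
    rw [hc]
    exact Submodule.smul_mem _ _ (Submodule.subset_span ⟨γ, hγ, rfl⟩)
  | zero => simp
  | add a b _ _ ha hb => rw [mul_add, add_mul]; exact add_mem ha hb
  | smul c a _ ha => rw [mul_smul_comm, smul_mul_assoc]; exact Submodule.smul_mem _ _ ha

theorem exists_mem_box_zero (hQ : IsMultAntisymm Q) (m : QuantumTorus Q) :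
    ∃ d, ∀ d', d ≤ d' → m ∈ box hQ 0 d' := by
  have hm := (basis hQ).span_eq.ge (Submodule.mem_top (x := m))
  induction hm using Submodule.span_induction with
  | mem m hm =>
    obtain ⟨γ, rfl⟩ := hm
    refine ⟨∑ i, (γ i).natAbs, fun d' hd' => ?_⟩
    rw [basis_apply]
    refine Submodule.subset_span ⟨γ, fun i => ?_, rfl⟩
    have := Finset.single_le_sum (f := fun i => (γ i).natAbs) (fun _ _ => Nat.zero_le _)
      (Finset.mem_univ i)
    simp only [Pi.zero_apply, sub_zero, Int.abs_eq_natAbs]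
    exact_mod_cast this.trans hd'
  | zero => exact ⟨0, fun _ _ => zero_mem _⟩
  | add a b _ _ ha hb =>
    obtain ⟨d, hd⟩ := ha
    obtain ⟨d', hd'⟩ := hb
    exact ⟨max d d', fun k hk => add_mem (hd k (by omega)) (hd' k (by omega))⟩
  | smul c a _ ha =>
    obtain ⟨d, hd⟩ := ha
    exact ⟨d, fun k hk => Submodule.smul_mem _ _ (hd k hk)⟩

/-- A `σ`-derivation moves exponents of monomials by a bounded amount. -/
theorem exists_map_monomial_mem_box (hQ : IsMultAntisymm Q)
    {σ : QuantumTorus Q ≃ₐ[K] QuantumTorus Q} (hσ : IsToric σ)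
    {δ : QuantumTorus Q →ₗ[K] QuantumTorus Q} (hδ : IsSkewDerivation σ δ) :
    ∃ d : ℕ, ∀ α, δ (monomial hQ α) ∈ box hQ α d := by
  obtain ⟨Λ, hΛ, hx⟩ := id hσ
  choose d hd using fun i => exists_mem_box_zero hQ (δ (x Q i) * ↑(gen Q i)⁻¹)
  refine ⟨∑ i, d i, fun α => ?_⟩
  set D := ∑ i, d i
  set W := box hQ 0 D
  have hconj : ∀ u : (QuantumTorus Q)ˣ,
      (∀ γ, ∃ c : K, c ≠ 0 ∧ (u * monomial hQ γ : QuantumTorus Q) =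
        c • (monomial hQ γ * u : QuantumTorus Q)) →
      (∀ m ∈ W, u * m * ↑u⁻¹ ∈ W) ∧ (∀ m ∈ W, ↑u⁻¹ * m * u ∈ W) := by
    refine fun u hu => ⟨fun m => mul_box_zero hQ D fun γ => ?_,
      fun m => mul_box_zero hQ D fun γ => ?_⟩
    · obtain ⟨c, -, h⟩ := hu γ
      exact ⟨c, by rw [h, smul_mul_assoc, mul_assoc, Units.mul_inv, mul_one]⟩
    · obtain ⟨c, hc, h⟩ := hu γ
      refine ⟨c⁻¹, ?_⟩
      rw [mul_assoc, eq_inv_smul_iff₀ hc, ← mul_smul_comm, ← h, Units.inv_mul_cancel_left]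
  -- The logarithmic derivative satisfies `δ(uv)(uv)⁻¹ = c u (δ(v) v⁻¹) u⁻¹ + δ(u) u⁻¹` when `σ(u) =
  -- c u`. Conjugation by monomials preserves `W`, so one box works for every `α`; the induction
  -- carries these facts along.
  have hm : δ (monomial hQ α) * ↑(monomial hQ α)⁻¹ ∈ W := by
    refine (monomial_induction hQ (P := fun _ u => (∃ c : K, σ u = c • (u : QuantumTorus Q)) ∧
      (∃ c : K, σ ↑u⁻¹ = c • (↑u⁻¹ : QuantumTorus Q)) ∧
      ((∀ m ∈ W, u * m * ↑u⁻¹ ∈ W) ∧ (∀ m ∈ W, ↑u⁻¹ * m * u ∈ W)) ∧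
      δ u * ↑u⁻¹ ∈ W) ?_ ?_ ?_ ?_ ?_ α).2.2.2
    · rintro c - u v hc h ⟨⟨d, hu⟩, ⟨d', hu'⟩, ⟨h1, h2⟩, h3⟩
      have hv : (↑v⁻¹ : QuantumTorus Q) = c⁻¹ • ↑u⁻¹ := by
        rw [Units.inv_eq_of_mul_eq_one_right]
        rw [h, smul_mul_smul_comm, mul_inv_cancel₀ hc, Units.mul_inv, one_smul]
      refine ⟨⟨d, by rw [h, map_smul, hu, smul_comm]⟩,
        ⟨d', by rw [hv, map_smul, hu', smul_comm]⟩, ⟨fun m hm => ?_, fun m hm => ?_⟩, ?_⟩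
      · simpa [h, hv, smul_smul, hc] using h1 m hm
      · simpa [h, hv, smul_smul, hc] using h2 m hm
      · simpa [h, hv, smul_smul, hc] using h3
    · exact ⟨⟨1, by simp⟩, ⟨1, by simp⟩, by simp, by simp [hδ.map_one]⟩
    · rintro - - u v ⟨⟨d, hu⟩, ⟨d', hu'⟩, ⟨h1, h2⟩, h3⟩ ⟨⟨e, hv⟩, ⟨e', hv'⟩, ⟨h1', h2'⟩, h3'⟩
      refine ⟨⟨d * e, by rw [Units.val_mul, map_mul, hu, hv, smul_mul_smul_comm]⟩,
        ⟨e' * d', by rw [mul_inv_rev, Units.val_mul, map_mul, hu', hv', smul_mul_smul_comm]⟩,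
        ⟨fun m hm => ?_, fun m hm => ?_⟩, ?_⟩
      · simpa [mul_assoc] using h1 _ (h1' m hm)
      · simpa [mul_assoc] using h2' _ (h2 m hm)
      · rw [mul_inv_rev, Units.val_mul, Units.val_mul, hδ, hu]
        have h4 := W.add_mem (W.smul_mem d (h1 _ h3')) h3
        convert h4 using 1
        simp [mul_assoc, add_mul]
    · rintro - u ⟨⟨d, hu⟩, ⟨d', hu'⟩, ⟨h1, h2⟩, h3⟩
      refine ⟨⟨d', hu'⟩, ⟨d, by simpa using hu⟩, ⟨fun m hm => ?_, fun m hm => ?_⟩, ?_⟩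
      · simpa using h2 m hm
      · simpa using h1 m hm
      · rw [hδ.map_units_inv, hu']
        have h4 := W.neg_mem (W.smul_mem d' (h2 _ h3))
        convert h4 using 1
        refine (neg_mul (_ : QuantumTorus Q) _).trans (congrArg _ ?_)
        simp only [inv_inv, smul_mul_assoc, mul_assoc]
    · intro i
      refine ⟨⟨Λ i, hx i⟩, ⟨(Λ i)⁻¹, ?_⟩, hconj _ (x_mul_monomial hQ i), ?_⟩
      · have h : ((Λ i)⁻¹ • (↑(gen Q i)⁻¹ : QuantumTorus Q)) * σ (gen Q i) = 1 := by
          rw [val_gen, hx, smul_mul_smul_comm, inv_mul_cancel₀ (hΛ i), ← val_gen, Units.inv_mul,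
            one_smul]
        have h' : σ (gen Q i) * σ ↑(gen Q i)⁻¹ = 1 := by rw [← map_mul, Units.mul_inv, map_one]
        exact (left_inv_eq_right_inv h h').symm
      · exact hd i D (Finset.single_le_sum (f := d) (fun _ _ => Nat.zero_le _) (Finset.mem_univ i))
  rw [← Units.inv_mul_cancel_right (δ (monomial hQ α)) (monomial hQ α)]
  have hbox : ∀ m ∈ W, m * monomial hQ α ∈ box hQ α D := by
    intro m hm
    induction hm using Submodule.span_induction with
    | mem m hm =>
      obtain ⟨γ, hγ, rfl⟩ := hm
      obtain ⟨c, -, h⟩ := monomial_mul hQ γ α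
      change (monomial hQ γ * monomial hQ α : QuantumTorus Q) ∈ _
      rw [h]
      refine Submodule.smul_mem _ _ (Submodule.subset_span ⟨γ + α, fun i => ?_, rfl⟩)
      simpa using hγ i
    | zero => simp
    | add a b _ _ ha hb => rw [add_mul]; exact add_mem ha hb
    | smul c a _ ha => rw [smul_mul_assoc]; exact Submodule.smul_mem _ _ ha
  have := hbox _ hm
  simpa using this

end QuantumTorus

/-! ### Polynomial growth and the Ore condition -/

section Growth

open Filter Topology in
theorem exists_lt_two_pow (C N d : ℕ) : ∃ k : ℕ, C * (k * d + 1) ^ N < 2 ^ k := by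
  have hlim := (tendsto_pow_const_div_const_pow_of_one_lt N (one_lt_two (α := ℝ))).comp
    (tendsto_add_atTop_nat 1)
  -- The factor `2` pays for the exponent `k + 1`, `C + 1` is positive even if `C = 0`, and `(d + 1)
  -- ^ N` comes from `k d + 1 ≤ (d + 1)(k + 1)`.
  have hC : (0 : ℝ) < 1 / (2 * (C + 1) * (d + 1) ^ N) := by positivity
  obtain ⟨k, hk⟩ := (hlim.eventually_lt_const hC).exists
  refine ⟨k, ?_⟩
  have h1 : ((k + 1 : ℕ) : ℝ) ^ N / 2 ^ (k + 1) < 1 / (2 * (C + 1) * (d + 1) ^ N) := hk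
  rw [div_lt_div_iff₀ (by positivity) (by positivity), pow_succ] at h1
  have h2 : (C + 1) * ((d + 1) * (k + 1)) ^ N < 2 ^ k := by
    have : (((C + 1) * ((d + 1) * (k + 1)) ^ N : ℕ) : ℝ) < ((2 ^ k : ℕ) : ℝ) := by
      push_cast [mul_pow] at h1 ⊢
      linarith
    exact_mod_cast this
  refine lt_of_le_of_lt (Nat.mul_le_mul (Nat.le_succ C) (Nat.pow_le_pow_left ?_ N)) h2
  nlinarith

variable {K S : Type*} [Field K]

/-- Otherwise `(s, t) ↦ f s - g t` embeds `V m × V m` in `V (m + d)`. Dimensions then double every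
`d` steps, against the polynomial bound. -/
theorem exists_map_eq_map_of_growth [AddCommGroup S] [Module K S] {V : ℕ → Submodule K S}
    [∀ m, FiniteDimensional K (V m)] (h0 : V 0 ≠ ⊥) {C N : ℕ}
    (hV : ∀ m, Module.finrank K (V m) ≤ C * (m + 1) ^ N) {f g : S →ₗ[K] S} {d : ℕ}
    (hf : ∀ m, ∀ s ∈ V m, f s ∈ V (m + d)) (hg : ∀ m, ∀ s ∈ V m, g s ∈ V (m + d)) :
    ∃ s t, (s ≠ 0 ∨ t ≠ 0) ∧ f s = g t := by
  by_contra! hcon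
  have hdouble : ∀ m, 2 * Module.finrank K (V m) ≤ Module.finrank K (V (m + d)) := fun m => by
    let L : (V m × V m) →ₗ[K] V (m + d) :=
      LinearMap.codRestrict _ ((f ∘ₗ (V m).subtype).coprod (-(g ∘ₗ (V m).subtype))) fun p => by
        simpa [← sub_eq_add_neg] using sub_mem (hf m _ p.1.2) (hg m _ p.2.2)
    have hL : Function.Injective L := by
      rw [injective_iff_map_eq_zero]
      rintro ⟨s, t⟩ hst
      have h : f s = g t := by
        have := congrArg Subtype.val hst
        simpa [L, ← sub_eq_add_neg, sub_eq_zero] using this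
      by_contra hne
      refine hcon s t ?_ h
      by_contra! hz
      exact hne (Prod.ext (Subtype.ext hz.1) (Subtype.ext hz.2))
    have := LinearMap.finrank_le_finrank_of_injective hL
    rw [Module.finrank_prod] at this
    omega
  have hpow : ∀ k, 2 ^ k ≤ Module.finrank K (V (k * d)) := fun k => by
    induction k with
    | zero =>
      rw [Nat.zero_mul, pow_zero, Nat.one_le_iff_ne_zero, Ne, Submodule.finrank_eq_zero]
      exact h0
    | succ k ih =>
      rw [pow_succ, Nat.succ_mul]
      have := hdouble (k * d)
      omega
  obtain ⟨k, hk⟩ := exists_lt_two_pow C N d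
  exact absurd ((hpow k).trans (hV _)) hk.not_ge

/-- A domain with an exhaustive multiplicative filtration of polynomial growth satisfies the left
and right Ore conditions. -/
theorem ore_of_growth [Ring S] [Algebra K S] [NoZeroDivisors S] {V : ℕ → Submodule K S}
    [∀ m, FiniteDimensional K (V m)] (h0 : V 0 ≠ ⊥)
    (hmul : ∀ m d, ∀ s ∈ V m, ∀ t ∈ V d, s * t ∈ V (m + d))
    (hmono : Monotone V) (hex : ∀ s, ∃ m, s ∈ V m) {C N : ℕ}
    (hV : ∀ m, Module.finrank K (V m) ≤ C * (m + 1) ^ N) {a b : S} (ha : a ≠ 0) (hb : b ≠ 0) :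
    (∃ s t, s ≠ 0 ∧ t ≠ 0 ∧ s * a = t * b) ∧ (∃ s t, s ≠ 0 ∧ t ≠ 0 ∧ a * s = b * t) := by
  obtain ⟨i, hi⟩ := hex a
  obtain ⟨j, hj⟩ := hex b
  have hi' := hmono (le_max_left i j) hi
  have hj' := hmono (le_max_right i j) hj
  constructor
  · obtain ⟨s, t, hst, h⟩ := exists_map_eq_map_of_growth h0 hV
      (f := LinearMap.mulRight K a) (g := LinearMap.mulRight K b)
      (fun m s hs => hmul m _ s hs _ hi') (fun m s hs => hmul m _ s hs _ hj')
    simp only [LinearMap.mulRight_apply] at h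
    refine ⟨s, t, ?_, ?_, h⟩
    · rintro rfl
      simp_all
    · rintro rfl
      simp_all
  · obtain ⟨s, t, hst, h⟩ := exists_map_eq_map_of_growth h0 hV
      (f := LinearMap.mulLeft K a) (g := LinearMap.mulLeft K b)
      (fun m s hs => add_comm m _ ▸ hmul _ m _ hi' s hs)
      (fun m s hs => add_comm m _ ▸ hmul _ m _ hj' s hs)
    simp only [LinearMap.mulLeft_apply] at h
    refine ⟨s, t, ?_, ?_, h⟩
    · rintro rfl
      simp_all
    · rintro rfl
      simp_all

end Growth

/-! ### The quotient division algebra of an Ore domain -/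

section Quotient

universe u₁ u₂

open nonZeroDivisors in
-- The left Ore condition gives the localization and its left fractions. The right one turns them
-- into right fractions: `a t = s b` yields `s⁻¹ a = b t⁻¹`.
theorem exists_isQuotientDivisionAlgebra {K : Type u₁} [Field K] {S : Type u₂} [Ring S]
    [Algebra K S] [Nontrivial S] [NoZeroDivisors S]
    (hore : ∀ a b : S, a ≠ 0 → b ≠ 0 →
      (∃ s t, s ≠ 0 ∧ t ≠ 0 ∧ s * a = t * b) ∧ (∃ s t, s ≠ 0 ∧ t ≠ 0 ∧ a * s = b * t)) :
    ∃ (D : Type u₂) (_ : DivisionRing D) (_ : Algebra K D) (f : S →ₐ[K] D),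
      IsQuotientDivisionAlgebra f := by
  have : Nonempty (OreLocalization.OreSet S⁰) := by
    rw [OreLocalization.nonempty_oreSet_iff_of_noZeroDivisors]
    intro r s
    rcases eq_or_ne r 0 with rfl | hr
    · exact ⟨0, 1, by simp⟩
    · obtain ⟨⟨s', r', hs', -, h⟩, -⟩ := hore r s hr (nonZeroDivisors.ne_zero s.2)
      exact ⟨r', ⟨s', mem_nonZeroDivisors_of_ne_zero hs'⟩, h⟩
  obtain ⟨_⟩ := this
  let f : S →ₐ[K] OreLocalization S⁰ S :=
    { OreLocalization.numeratorRingHom with commutes' := fun _ => rfl }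
  have hinj : Function.Injective f := OreLocalization.numeratorHom_inj inf_le_left
  have hf0 : ∀ s, s ≠ 0 → f s ≠ 0 := fun s hs => (map_ne_zero_iff f hinj).2 hs
  have hleft : ∀ d, ∃ a s : S, s ≠ 0 ∧ d = (f s)⁻¹ * f a := fun d => by
    induction d using OreLocalization.ind with
    | _ r s =>
      have hs := nonZeroDivisors.ne_zero s.2
      refine ⟨r, s, hs, ?_⟩
      rw [eq_inv_mul_iff_mul_eq₀ (hf0 _ hs)]
      change ((s : S) /ₒ 1 : OreLocalization S⁰ S) * (r /ₒ s) = r /ₒ 1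
      exact OreLocalization.mul_cancel
  refine ⟨OreLocalization S⁰ S, inferInstance, inferInstance, f, hinj, fun d => ?_, hleft⟩
  obtain ⟨a, s, hs, rfl⟩ := hleft d
  rcases eq_or_ne a 0 with rfl | ha
  · exact ⟨0, 1, one_ne_zero, by simp⟩
  · obtain ⟨-, t, b, ht, -, h⟩ := hore a s ha hs
    refine ⟨b, t, ht, ?_⟩
    rw [eq_mul_inv_iff_mul_eq₀ (hf0 t ht), mul_assoc, ← map_mul, h, map_mul,
      inv_mul_cancel_left₀ (hf0 s hs)]

end Quotient

/-! ### Degrees in Ore extensions -/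

namespace IsOreExtension

variable {K R S : Type*} [Field K] [Ring R] [Algebra K R] [Ring S] [Algebra K S]
  {σ : R ≃ₐ[K] R} {δ : R →ₗ[K] R} {ι : R →ₐ[K] S} {x : S}

/-- The left polynomials in `x` of degree less than `m`. -/
def degreeLT (ι : R →ₐ[K] S) (x : S) (m : ℕ) : Submodule K S :=
  Submodule.span K {s | ∃ i < m, ∃ r, s = ι r * x ^ i}

theorem mul_pow_mem_degreeLT {i m : ℕ} (h : i < m) (r : R) : ι r * x ^ i ∈ degreeLT ι x m :=
  Submodule.subset_span ⟨i, h, r, rfl⟩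

theorem degreeLT_mono {m k : ℕ} (h : m ≤ k) : degreeLT ι x m ≤ degreeLT ι x k :=
  Submodule.span_mono fun _ ⟨i, hi, r, hr⟩ => ⟨i, hi.trans_le h, r, hr⟩

theorem degreeLT_le {m : ℕ} {W : Submodule K S} (h : ∀ i < m, ∀ r, ι r * x ^ i ∈ W) :
    degreeLT ι x m ≤ W := by
  refine Submodule.span_le.2 ?_
  rintro _ ⟨i, hi, r, rfl⟩
  exact h i hi r

theorem coe_mul_mem_degreeLT (r : R) {m : ℕ} {s : S} (hs : s ∈ degreeLT ι x m) :
    ι r * s ∈ degreeLT ι x m := by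
  refine degreeLT_le (W := (degreeLT ι x m).comap (LinearMap.mulLeft K (ι r))) (fun i hi r' => ?_) hs
  rw [Submodule.mem_comap, LinearMap.mulLeft_apply, ← mul_assoc, ← map_mul]
  exact mul_pow_mem_degreeLT hi _

theorem mul_pow_mem {m : ℕ} {s : S} (hs : s ∈ degreeLT ι x m) (k : ℕ) :
    s * x ^ k ∈ degreeLT ι x (m + k) := by
  refine degreeLT_le (W := (degreeLT ι x (m + k)).comap (LinearMap.mulRight K (x ^ k)))
    (fun i hi r => ?_) hs
  rw [Submodule.mem_comap, LinearMap.mulRight_apply, mul_assoc, ← pow_add]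
  exact mul_pow_mem_degreeLT (by omega) _

theorem x_mul_mem (hS : IsOreExtension σ δ ι x) {m : ℕ} {s : S}
    (hs : s ∈ degreeLT ι x m) : x * s ∈ degreeLT ι x (m + 1) := by
  refine degreeLT_le (W := (degreeLT ι x (m + 1)).comap (LinearMap.mulLeft K x))
    (fun i hi r => ?_) hs
  rw [Submodule.mem_comap, LinearMap.mulLeft_apply, ← mul_assoc, hS.comm, add_mul, mul_assoc,
    ← pow_succ']
  exact add_mem (mul_pow_mem_degreeLT (by omega) _) (mul_pow_mem_degreeLT (by omega) _)

theorem x_pow_mul_mem (hS : IsOreExtension σ δ ι x) {m : ℕ} {s : S}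
    (hs : s ∈ degreeLT ι x m) (k : ℕ) :
    x ^ k * s ∈ degreeLT ι x (k + m) := by
  induction k with
  | zero => simpa using hs
  | succ k ih =>
    rw [pow_succ', mul_assoc, add_right_comm]
    exact hS.x_mul_mem ih

/-- Degrees below `m` and at most `k` add up to a degree below `m + k`, hence the `k + 1` in the
second hypothesis. -/
theorem mul_mem_degreeLT (hS : IsOreExtension σ δ ι x) {m k : ℕ} {s t : S}
    (hs : s ∈ degreeLT ι x m) (ht : t ∈ degreeLT ι x (k + 1)) : s * t ∈ degreeLT ι x (m + k) := by
  refine degreeLT_le (W := (degreeLT ι x (m + k)).comap (LinearMap.mulRight K t))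
    (fun i hi r => ?_) hs
  rw [Submodule.mem_comap, LinearMap.mulRight_apply, mul_assoc]
  exact coe_mul_mem_degreeLT _ (degreeLT_mono (by omega) (hS.x_pow_mul_mem ht i))

theorem x_pow_mul (hS : IsOreExtension σ δ ι x) (r : R) (k : ℕ) :
    x ^ k * ι r - ι (σ^[k] r) * x ^ k ∈ degreeLT ι x k := by
  induction k with
  | zero => simp
  | succ k ih =>
    have h : x ^ (k + 1) * ι r - ι (σ^[k + 1] r) * x ^ (k + 1) =
        x * (x ^ k * ι r - ι (σ^[k] r) * x ^ k) + ι (δ (σ^[k] r)) * x ^ k := by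
      rw [mul_sub, ← mul_assoc x (ι _), hS.comm, Function.iterate_succ_apply', pow_succ' x]
      noncomm_ring
    rw [h]
    exact add_mem (hS.x_mul_mem ih) (mul_pow_mem_degreeLT (by omega) _)

/-- The element `s` has degree `m` as a left polynomial in `x`. -/
def HasDegree (ι : R →ₐ[K] S) (x : S) (m : ℕ) (s : S) : Prop :=
  ∃ c, c ≠ 0 ∧ s - ι c * x ^ m ∈ degreeLT ι x m

theorem HasDegree.mem {m : ℕ} {s : S} (h : HasDegree ι x m s) : s ∈ degreeLT ι x (m + 1) := by
  obtain ⟨c, -, hs⟩ := h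
  have := add_mem (degreeLT_mono (Nat.le_succ m) hs) (mul_pow_mem_degreeLT (Nat.lt_succ_self m) c)
  rwa [sub_add_cancel] at this

theorem HasDegree.add {m : ℕ} {s t : S} (h : HasDegree ι x m s) (ht : t ∈ degreeLT ι x m) :
    HasDegree ι x m (s + t) := by
  obtain ⟨c, hc, hs⟩ := h
  refine ⟨c, hc, ?_⟩
  rw [add_sub_right_comm]
  exact add_mem hs ht

theorem hasDegree_coe {r : R} (hr : r ≠ 0) : HasDegree ι x 0 (ι r) := ⟨r, hr, by simp⟩

theorem hasDegree_coe_mul {r : R} (hr : r ≠ 0) : HasDegree ι x 1 (ι r * x) := ⟨r, hr, by simp⟩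

/-- The leading coefficient of the product is `c σ^m(d)`, non-zero since `σ` is injective and `R`
has no zero divisors. -/
theorem HasDegree.mul [NoZeroDivisors R] (hS : IsOreExtension σ δ ι x) {m k : ℕ} {s t : S}
    (hs : HasDegree ι x m s) (ht : HasDegree ι x k t) : HasDegree ι x (m + k) (s * t) := by
  have ht' := ht.mem
  obtain ⟨c, hc, hs⟩ := hs
  obtain ⟨d, hd, ht⟩ := ht
  refine ⟨c * σ^[m] d, mul_ne_zero hc ?_, ?_⟩
  · rw [← AlgEquiv.coe_pow]
    exact (map_ne_zero_iff _ (σ ^ m).injective).2 hd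
  · have h : s * t - ι (c * σ^[m] d) * x ^ (m + k) = (s - ι c * x ^ m) * t +
        ι c * (x ^ m * (t - ι d * x ^ k)) +
        ι c * ((x ^ m * ι d - ι (σ^[m] d) * x ^ m) * x ^ k) := by
      rw [pow_add, map_mul]
      noncomm_ring
    rw [h]
    exact add_mem (add_mem (hS.mul_mem_degreeLT hs ht')
      (coe_mul_mem_degreeLT _ (hS.x_pow_mul_mem ht m)))
      (coe_mul_mem_degreeLT _ (mul_pow_mem (hS.x_pow_mul d m) k))

theorem exists_sum_of_mem_degreeLT {m : ℕ} {s : S} (hs : s ∈ degreeLT ι x m) :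
    ∃ c : ℕ →₀ R, (∀ i, m ≤ i → c i = 0) ∧ s = c.sum fun i r => ι r * x ^ i := by
  induction hs using Submodule.span_induction with
  | mem s hs =>
    obtain ⟨i, hi, r, rfl⟩ := hs
    exact ⟨Finsupp.single i r, fun j hj => Finsupp.single_eq_of_ne (by omega), by simp⟩
  | zero => exact ⟨0, by simp⟩
  | add s t _ _ hs ht =>
    obtain ⟨c, hc, rfl⟩ := hs
    obtain ⟨d, hd, rfl⟩ := ht
    refine ⟨c + d, fun i hi => by simp [hc i hi, hd i hi], ?_⟩
    rw [Finsupp.sum_add_index'] <;> simp [add_mul]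
  | smul k s _ hs =>
    obtain ⟨c, hc, rfl⟩ := hs
    refine ⟨k • c, fun i hi => by simp [hc i hi], ?_⟩
    rw [Finsupp.sum_smul_index', Finsupp.smul_sum] <;> simp

theorem HasDegree.ne_zero (hS : IsOreExtension σ δ ι x) {m : ℕ} {s : S}
    (hs : HasDegree ι x m s) : s ≠ 0 := by
  rintro rfl
  obtain ⟨c, hc, h⟩ := hs
  obtain ⟨d, hd, h'⟩ := exists_sum_of_mem_degreeLT h
  have h0 : (0 : S) = (d + Finsupp.single m c).sum fun i r => ι r * x ^ i := by
    rw [Finsupp.sum_add_index', ← h']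
    · simp
    · simp
    · simp [add_mul]
  have := (hS.basis 0).unique h0 (y₂ := 0) (by simp)
  have := DFunLike.congr_fun this m
  simp [hd m le_rfl] at this
  exact hc this

theorem exists_hasDegree (hS : IsOreExtension σ δ ι x) {s : S} (hs : s ≠ 0) :
    ∃ m, HasDegree ι x m s := by
  obtain ⟨c, rfl, -⟩ := hS.basis s
  have hne : c.support.Nonempty := by
    rw [Finsupp.support_nonempty_iff]
    rintro rfl
    simp at hs
  refine ⟨c.support.max' hne, c (c.support.max' hne),
    Finsupp.mem_support_iff.1 (Finset.max'_mem _ _), ?_⟩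
  rw [Finsupp.sum, ← Finset.sum_erase_eq_sub (Finset.max'_mem _ hne)]
  refine Submodule.sum_mem _ fun i hi => mul_pow_mem_degreeLT ?_ _
  exact lt_of_le_of_ne (Finset.le_max' _ _ (Finset.mem_of_mem_erase hi)) (Finset.ne_of_mem_erase hi)

theorem noZeroDivisors [NoZeroDivisors R] (hS : IsOreExtension σ δ ι x) : NoZeroDivisors S where
  eq_zero_or_eq_zero_of_mul_eq_zero := by
    intro a b hab
    by_contra! h
    obtain ⟨m, hm⟩ := hS.exists_hasDegree h.1
    obtain ⟨k, hk⟩ := hS.exists_hasDegree h.2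
    exact (hm.mul hS hk).ne_zero hS hab

theorem injective (hS : IsOreExtension σ δ ι x) : Function.Injective ι := by
  rw [injective_iff_map_eq_zero]
  intro r hr
  by_contra hne
  exact (hasDegree_coe (x := x) hne).ne_zero hS hr

theorem HasDegree.pow [NoZeroDivisors R] [Nontrivial R] (hS : IsOreExtension σ δ ι x) {y : S}
    (hy : HasDegree ι x 1 y) (k : ℕ) : HasDegree ι x k (y ^ k) := by
  induction k with
  | zero => simpa using hasDegree_coe (ι := ι) (x := x) (one_ne_zero (α := R))
  | succ k ih =>
    rw [pow_succ]
    exact ih.mul hS hy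

/-- A sequence of elements of strictly increasing degrees is left linearly independent. -/
theorem eq_zero_of_sum_eq_zero [NoZeroDivisors R] (hS : IsOreExtension σ δ ι x) {g : ℕ → S}
    (hg : ∀ i, HasDegree ι x i (g i)) {s : Finset ℕ} {c : ℕ → R}
    (h : ∑ i ∈ s, ι (c i) * g i = 0) : ∀ i ∈ s, c i = 0 := by
  classical
  induction s using Finset.induction_on_max with
  | empty => simp
  | insert m s hm ih =>
    rw [Finset.sum_insert fun h => lt_irrefl m (hm m h)] at h
    have hcm : c m = 0 := by
      by_contra hc
      have h1 := (hasDegree_coe (x := x) (ι := ι) hc).mul hS (hg m)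
      rw [zero_add] at h1
      refine (h1.add (Submodule.sum_mem _ fun i hi => ?_)).ne_zero hS h
      exact coe_mul_mem_degreeLT _ (degreeLT_mono (hm i hi) (hg i).mem)
    rw [hcm, map_zero, zero_mul, zero_add] at h
    simpa [hcm] using ih h

theorem adjoin_eq_top (hS : IsOreExtension σ δ ι x) : Algebra.adjoin K (Set.range ι ∪ {x}) = ⊤ := by
  rw [eq_top_iff]
  rintro s -
  obtain ⟨c, rfl, -⟩ := hS.basis s
  refine Subalgebra.sum_mem _ fun i _ => mul_mem (Algebra.subset_adjoin (Or.inl ⟨_, rfl⟩))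
    (pow_mem (Algebra.subset_adjoin (Set.mem_union_right _ (Set.mem_singleton x))) _)

end IsOreExtension

/-! ### The Ore condition for extensions of the quantum torus -/

namespace QuantumTorus

variable {K : Type*} [Field K] {n : ℕ} {Q : Matrix (Fin n) (Fin n) K}
  {σ : QuantumTorus Q ≃ₐ[K] QuantumTorus Q} {δ : QuantumTorus Q →ₗ[K] QuantumTorus Q}
  {S : Type*} [Ring S] [Algebra K S] {ι : QuantumTorus Q →ₐ[K] S} {x : S}

/-- The exponents `(α, k)` with `|α_i| ≤ m * d` and `k ≤ m`. -/
noncomputable def boundedExponents (n d m : ℕ) : Finset ((Fin n → ℤ) × ℕ) :=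
  (Fintype.piFinset fun _ => Finset.Icc (-(m * d : ℤ)) (m * d)) ×ˢ Finset.range (m + 1)

theorem mem_boundedExponents {d m : ℕ} {p : (Fin n → ℤ) × ℕ} :
    p ∈ boundedExponents n d m ↔ (∀ i, |p.1 i| ≤ m * d) ∧ p.2 ≤ m := by
  simp [boundedExponents, abs_le]

/-- The count `(2md + 1)^n (m + 1)` is estimated through `2md + 1 ≤ (2d + 1)(m + 1)`. -/
theorem card_boundedExponents (n d m : ℕ) :
    (boundedExponents n d m).card ≤ (2 * d + 1) ^ n * (m + 1) ^ (n + 1) := by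
  have h : ((m * d : ℤ) + 1 - -(m * d)).toNat = 2 * (m * d) + 1 := by
    have : (m * d : ℤ) + 1 - -(m * d) = ((2 * (m * d) + 1 : ℕ) : ℤ) := by push_cast; ring
    rw [this, Int.toNat_natCast]
  rw [boundedExponents, Finset.card_product, Fintype.card_piFinset, Finset.card_range]
  simp only [Int.card_Icc, h, Finset.prod_const, Finset.card_univ, Fintype.card_fin]
  rw [pow_succ (m + 1), ← mul_assoc (_ ^ n), ← mul_pow]
  refine Nat.mul_le_mul_right _ (Nat.pow_le_pow_left ?_ n)
  nlinarith

/-- The span of the elements `x^α x^k` of an Ore extension with `(α, k)` bounded. -/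
noncomputable def boundedSpan (hQ : IsMultAntisymm Q) (ι : QuantumTorus Q →ₐ[K] S) (x : S)
    (d m : ℕ) : Submodule K S :=
  Submodule.span K ((fun p : (Fin n → ℤ) × ℕ => ι (monomial hQ p.1) * x ^ p.2) ''
    (boundedExponents n d m : Set ((Fin n → ℤ) × ℕ)))

instance (hQ : IsMultAntisymm Q) (ι : QuantumTorus Q →ₐ[K] S) (x : S) (d m : ℕ) :
    FiniteDimensional K (boundedSpan hQ ι x d m) :=
  FiniteDimensional.span_of_finite K ((Finset.finite_toSet _).image _)

theorem finrank_boundedSpan_le (hQ : IsMultAntisymm Q) (ι : QuantumTorus Q →ₐ[K] S) (x : S)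
    (d m : ℕ) :
    Module.finrank K (boundedSpan hQ ι x d m) ≤ (2 * d + 1) ^ n * (m + 1) ^ (n + 1) := by
  classical
  refine le_trans ?_ (card_boundedExponents n d m)
  rw [boundedSpan, ← Finset.coe_image]
  exact (finrank_span_finset_le_card _).trans Finset.card_image_le

theorem mul_pow_mem_boundedSpan (hQ : IsMultAntisymm Q) {d m : ℕ} {α : Fin n → ℤ} {k : ℕ}
    (hα : ∀ i, |α i| ≤ m * d) (hk : k ≤ m) :
    ι (monomial hQ α) * x ^ k ∈ boundedSpan hQ ι x d m :=
  Submodule.subset_span ⟨(α, k), mem_boundedExponents.2 ⟨hα, hk⟩, rfl⟩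

/-- Left multiplication by a generator displaces exponents by at most `d + 1`: at most `d` through
`δ`, at most `1` through a monomial. That is the room gained from `m` to `m + 1`. -/
theorem mul_mem_boundedSpan (hQ : IsMultAntisymm Q) (hσ : IsToric σ)
    (hS : IsOreExtension σ δ ι x) {d : ℕ} (hd : ∀ α, δ (monomial hQ α) ∈ box hQ α d) {g : S}
    (hg : g = x ∨ ∃ β : Fin n → ℤ, (∀ i, |β i| ≤ 1) ∧ g = ι (monomial hQ β)) {m : ℕ} {s : S}
    (hs : s ∈ boundedSpan hQ ι x (d + 1) m) : g * s ∈ boundedSpan hQ ι x (d + 1) (m + 1) := by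
  induction hs using Submodule.span_induction with
  | mem s hs =>
    obtain ⟨⟨α, k⟩, hp, rfl⟩ := hs
    obtain ⟨hα, hk⟩ := mem_boundedExponents.1 hp
    dsimp only at hα hk ⊢
    push_cast at hα
    have hbig : ∀ γ : Fin n → ℤ, (∀ i, |γ i - α i| ≤ d + 1) →
        ∀ i, |γ i| ≤ ((m + 1 : ℕ) : ℤ) * ((d + 1 : ℕ) : ℤ) := fun γ hγ i => by
      have := abs_add_le (γ i - α i) (α i)
      rw [sub_add_cancel] at this
      push_cast
      linarith [hγ i, hα i]
    rcases hg with rfl | ⟨β, hβ, rfl⟩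
    · obtain ⟨c, -, hc⟩ := hσ.map_monomial hQ α
      rw [← mul_assoc, hS.comm, add_mul, hc, map_smul, smul_mul_assoc, smul_mul_assoc, mul_assoc,
        ← pow_succ']
      refine add_mem (Submodule.smul_mem _ _ (mul_pow_mem_boundedSpan hQ
        (hbig α fun i => ?_) (by omega))) ?_
      · rw [sub_self, abs_zero]; positivity
      · have := hd α
        generalize δ (monomial hQ α) = r at this
        induction this using Submodule.span_induction with
        | mem r hr =>
          obtain ⟨γ, hγ, rfl⟩ := hr
          exact mul_pow_mem_boundedSpan hQ (hbig γ fun i => (hγ i).trans (by linarith)) (by omega)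
        | zero => simp
        | add a b _ _ ha hb => rw [map_add, add_mul]; exact add_mem ha hb
        | smul c a _ ha => rw [map_smul, smul_mul_assoc]; exact Submodule.smul_mem _ _ ha
    · obtain ⟨c, -, hc⟩ := monomial_mul hQ β α
      rw [← mul_assoc, ← map_mul, hc, map_smul, smul_mul_assoc]
      refine Submodule.smul_mem _ _ (mul_pow_mem_boundedSpan hQ (hbig _ fun i => ?_) (by omega))
      rw [Pi.add_apply, add_sub_cancel_right]
      exact (hβ i).trans (by linarith [Int.natCast_nonneg d])
  | zero => simp
  | add a b _ _ ha hb => rw [mul_add]; exact add_mem ha hb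
  | smul c a _ ha => rw [mul_smul_comm]; exact Submodule.smul_mem _ _ ha

/-- An Ore extension of a quantum torus by a toric automorphism is a left and right Ore domain. -/
theorem ore_oreExtension (hQ : IsMultAntisymm Q) (hσ : IsToric σ) (hδ : IsSkewDerivation σ δ)
    (hS : IsOreExtension σ δ ι x) {a b : S} (ha : a ≠ 0) (hb : b ≠ 0) :
    (∃ s t, s ≠ 0 ∧ t ≠ 0 ∧ s * a = t * b) ∧ (∃ s t, s ≠ 0 ∧ t ≠ 0 ∧ a * s = b * t) := by
  have := noZeroDivisors hQ
  have := hS.noZeroDivisors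
  have := nontrivial hQ
  have := hS.injective.nontrivial
  obtain ⟨d, hd⟩ := exists_map_monomial_mem_box hQ hσ hδ
  -- The filtration is by powers of the span `G` of this generating set, which makes it
  -- multiplicative for free; `boundedSpan` serves only to bound dimensions.
  let A : Set S := {g | g = x ∨ ∃ β : Fin n → ℤ, (∀ i, |β i| ≤ 1) ∧ g = ι (monomial hQ β)}
  let G := Submodule.span K A
  have hA : ∀ g ∈ A, g ∈ G := fun g hg => Submodule.subset_span hg
  have hmon : ∀ β : Fin n → ℤ, (∀ i, |β i| ≤ 1) → ι (monomial hQ β) ∈ G := fun β hβ =>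
    hA _ (Or.inr ⟨β, hβ, rfl⟩)
  have hsingle : ∀ i j : Fin n, |(Pi.single i 1 : Fin n → ℤ) j| ≤ 1 := fun i j => by
    rcases eq_or_ne j i with rfl | h
    · simp
    · simp [h]
  have hG1 : (1 : S) ∈ G := by
    obtain ⟨c, hc, h⟩ := monomial_zero hQ
    have := G.smul_mem c⁻¹ (hmon 0 (by simp))
    rwa [h, map_smul, inv_smul_smul₀ hc, map_one] at this
  have hGle : ∀ m, ∀ g ∈ G, ∀ s ∈ boundedSpan hQ ι x (d + 1) m,
      g * s ∈ boundedSpan hQ ι x (d + 1) (m + 1) := fun m g hg s hs => by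
    induction hg using Submodule.span_induction with
    | mem g hg => exact mul_mem_boundedSpan hQ hσ hS hd hg hs
    | zero => simp
    | add a b _ _ ha hb => rw [add_mul]; exact add_mem ha hb
    | smul c a _ ha => rw [smul_mul_assoc]; exact Submodule.smul_mem _ _ ha
  have hVle : ∀ m, G ^ m ≤ boundedSpan hQ ι x (d + 1) m := fun m => by
    induction m with
    | zero =>
      rw [pow_zero, Submodule.one_le]
      obtain ⟨c, hc, h⟩ := monomial_zero hQ
      have := (boundedSpan hQ ι x (d + 1) 0).smul_mem c⁻¹
        (mul_pow_mem_boundedSpan (ι := ι) (x := x) hQ (α := 0) (k := 0) (by simp) le_rfl)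
      rwa [h, map_smul, pow_zero, mul_one, inv_smul_smul₀ hc, map_one] at this
    | succ m ih =>
      rw [pow_succ', Submodule.mul_le]
      exact fun g hg s hs => hGle m g hg s (ih hs)
  have hfd : ∀ m, FiniteDimensional K ↥(G ^ m) := fun m => Submodule.finiteDimensional_of_le (hVle m)
  have hmul : ∀ m k, ∀ s ∈ G ^ m, ∀ t ∈ G ^ k, s * t ∈ G ^ (m + k) := fun m k s hs t ht => by
    rw [pow_add]
    exact Submodule.mul_mem_mul hs ht
  have hmono : Monotone fun m => G ^ m := by
    refine monotone_nat_of_le_succ fun m s hs => ?_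
    have := hmul m 1 s hs 1 (by rwa [pow_one])
    rwa [mul_one] at this
  have hex : ∀ s, ∃ m, s ∈ G ^ m := by
    let B : Subalgebra K S :=
      { carrier := {s | ∃ m, s ∈ G ^ m}
        mul_mem' := fun ⟨i, hi⟩ ⟨j, hj⟩ => ⟨i + j, hmul i j _ hi _ hj⟩
        add_mem' := fun ⟨i, hi⟩ ⟨j, hj⟩ => ⟨max i j,
          add_mem (hmono (le_max_left i j) hi) (hmono (le_max_right i j) hj)⟩
        algebraMap_mem' := fun c => ⟨0, by
          rw [Algebra.algebraMap_eq_smul_one, pow_zero]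
          exact Submodule.smul_mem _ _ (Submodule.one_le.1 le_rfl)⟩ }
    have hGB : ∀ s ∈ G, s ∈ B := fun s hs => ⟨1, by rwa [pow_one]⟩
    have hTB : ∀ r, ι r ∈ B := fun r => by
      induction r using induction with
      | algebraMap c => rw [AlgHom.commutes]; exact B.algebraMap_mem c
      | add a b ha hb => rw [map_add]; exact add_mem ha hb
      | mul a b ha hb => rw [map_mul]; exact mul_mem ha hb
      | gen i =>
        obtain ⟨c, hc, h⟩ := monomial_single hQ i
        have := B.smul_mem (hGB _ (hmon _ (hsingle i))) c⁻¹
        rwa [h, map_smul, inv_smul_smul₀ hc] at this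
      | gen_inv i =>
        obtain ⟨c, hc, h⟩ := monomial_neg_single hQ i
        have := B.smul_mem (hGB _ (hmon (-Pi.single i 1) fun j => by
          rw [Pi.neg_apply, abs_neg]; exact hsingle i j)) c⁻¹
        rwa [h, map_smul, inv_smul_smul₀ hc] at this
    have hB : Algebra.adjoin K (Set.range ι ∪ {x}) ≤ B := by
      rw [Algebra.adjoin_le_iff]
      rintro s (⟨r, rfl⟩ | rfl)
      · exact hTB r
      · exact hGB _ (hA _ (Or.inl rfl))
    rw [hS.adjoin_eq_top] at hB
    exact fun s => hB trivial
  refine ore_of_growth (V := fun m => G ^ m) (fun h0 => ?_) hmul hmono hex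
    (fun m => (Submodule.finrank_mono (hVle m)).trans (finrank_boundedSpan_le hQ ι x (d + 1) m))
    ha hb
  have h1 : (1 : S) ∈ G ^ 0 := by rw [pow_zero]; exact Submodule.one_le.1 le_rfl
  have h0' : G ^ 0 = ⊥ := h0
  rw [h0', Submodule.mem_bot] at h1
  exact one_ne_zero h1

end QuantumTorus

/-! ### The first Weyl algebra -/

section Weyl

variable {K : Type*} [Field K]

namespace WeylAlgebraOne

/-- The generator of index `i` of the first Weyl algebra. -/
noncomputable def gen (K : Type*) [Field K] (i : Fin 2) : WeylAlgebraOne K :=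
  RingQuot.mkAlgHom K (WeylRel K) (FreeAlgebra.ι K i)

theorem gen_zero_mul_gen_one : gen K 0 * gen K 1 = gen K 1 * gen K 0 + 1 := by
  have := RingQuot.mkAlgHom_rel K (WeylRel.comm (K := K))
  rw [map_sub, map_mul, map_mul, map_one] at this
  rw [add_comm]
  exact sub_eq_iff_eq_add.1 this

/-- The truncated `i - 1` is harmless at `i = 0`, where its coefficient vanishes. -/
theorem gen_zero_mul_pow (i : ℕ) :
    gen K 0 * gen K 1 ^ i = gen K 1 ^ i * gen K 0 + (i : K) • gen K 1 ^ (i - 1) := by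
  induction i with
  | zero => simp
  | succ i ih =>
    rw [pow_succ, ← mul_assoc, ih, add_mul, mul_assoc _ (gen K 0), gen_zero_mul_gen_one, mul_add,
      mul_one, add_assoc, mul_assoc, smul_mul_assoc, Nat.add_sub_cancel]
    congr 1
    rcases Nat.eq_zero_or_pos i with rfl | hi
    · simp
    · rw [← pow_succ, Nat.sub_add_cancel hi]
      push_cast
      rw [add_smul, one_smul, add_comm]

/-- The span of the `q^i p^j` contains `1` and is stable under left multiplication by `p` and `q`.
Uniqueness is not needed: independence is checked in the target division algebra. -/
theorem exists_eq_sum (w : WeylAlgebraOne K) :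
    ∃ c : ℕ →₀ Polynomial K, w = c.sum fun j r => Polynomial.aeval (gen K 1) r * gen K 0 ^ j := by
  let W : Submodule K (WeylAlgebraOne K) :=
    Submodule.span K (Set.range fun p : ℕ × ℕ => gen K 1 ^ p.1 * gen K 0 ^ p.2)
  have hW : ∀ i j, gen K 1 ^ i * gen K 0 ^ j ∈ W := fun i j => Submodule.subset_span ⟨(i, j), rfl⟩
  have hgen : ∀ k, ∀ w ∈ W, gen K k * w ∈ W := by
    intro k w hw
    induction hw using Submodule.span_induction with
    | mem w hw =>
      obtain ⟨⟨i, j⟩, rfl⟩ := hw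
      dsimp only
      fin_cases k
      · dsimp only [Fin.zero_eta]
        rw [← mul_assoc, gen_zero_mul_pow, add_mul, mul_assoc, ← pow_succ', smul_mul_assoc]
        exact add_mem (hW _ _) (W.smul_mem _ (hW _ _))
      · dsimp only [Fin.mk_one]
        rw [← mul_assoc, ← pow_succ']
        exact hW _ _
    | zero => simp
    | add a b _ _ ha hb => rw [mul_add]; exact add_mem ha hb
    | smul c a _ ha => rw [mul_smul_comm]; exact W.smul_mem _ ha
  have hall : ∀ a : FreeAlgebra K (Fin 2), ∀ w ∈ W, RingQuot.mkAlgHom K (WeylRel K) a * w ∈ W := by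
    intro a
    induction a using FreeAlgebra.induction with
    | grade0 c =>
      intro w hw
      rw [AlgHom.commutes, ← Algebra.smul_def]
      exact W.smul_mem _ hw
    | grade1 i => exact hgen i
    | mul a b ha hb =>
      intro w hw
      rw [map_mul, mul_assoc]
      exact ha _ (hb _ hw)
    | add a b ha hb =>
      intro w hw
      rw [map_add, add_mul]
      exact add_mem (ha _ hw) (hb _ hw)
  have hw : w ∈ W := by
    obtain ⟨a, rfl⟩ := RingQuot.mkAlgHom_surjective K (WeylRel K) w
    simpa using hall a _ (hW 0 0)
  induction hw using Submodule.span_induction with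
  | mem w hw =>
    obtain ⟨⟨i, j⟩, rfl⟩ := hw
    exact ⟨Finsupp.single j (Polynomial.X ^ i), by simp⟩
  | zero => exact ⟨0, by simp⟩
  | add a b _ _ ha hb =>
    obtain ⟨c, rfl⟩ := ha
    obtain ⟨d, rfl⟩ := hb
    refine ⟨c + d, ?_⟩
    rw [Finsupp.sum_add_index'] <;> simp [add_mul]
  | smul k a _ ha =>
    obtain ⟨c, rfl⟩ := ha
    refine ⟨k • c, ?_⟩
    rw [Finsupp.sum_smul_index', Finsupp.smul_sum] <;> simp

/-- The universal property of the first Weyl algebra. -/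
noncomputable def lift {B : Type*} [Ring B] [Algebra K B] (p q : B) (h : p * q - q * p = 1) :
    WeylAlgebraOne K →ₐ[K] B :=
  RingQuot.liftAlgHom K ⟨FreeAlgebra.lift K ![p, q], by
    rintro _ _ ⟨⟩
    simpa using h⟩

theorem lift_gen {B : Type*} [Ring B] [Algebra K B] (p q : B) (h : p * q - q * p = 1) (i : Fin 2) :
    lift p q h (gen K i) = ![p, q] i := by
  rw [lift, gen, RingQuot.liftAlgHom_mkAlgHom_apply]; simp

end WeylAlgebraOne

end Weyl

/-! ### Weyl algebras from derivations -/

section Derivation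

variable {K R S D : Type*} [Field K] [Ring R] [Algebra K R] [Ring S] [Algebra K S]
  [DivisionRing D] [Algebra K D]

/-- The commutator with `Y` is a derivation sending `U` to `V`, and `V` commutes with `U`, so the
power rule holds. It is used to clear denominators in powers of `U⁻¹ Y`. -/
theorem mul_mul_pow_of_commute {D : Type*} [Ring D] {Y U V : D} (h : Y * U = U * Y + V)
    (hV : Commute V U) (k : ℕ) : U * Y * U ^ k = U ^ (k + 1) * Y + k * V * U ^ k := by
  induction k with
  | zero => simp
  | succ k ih =>
    have hc : U ^ (k + 1) * V = V * U ^ (k + 1) := (hV.pow_right _).symm.eq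
    calc U * Y * U ^ (k + 1) = (U * Y * U ^ k) * U := by rw [pow_succ]; noncomm_ring
      _ = U ^ (k + 1) * (Y * U) + k * V * U ^ (k + 1) := by rw [ih, pow_succ]; noncomm_ring
      _ = U ^ (k + 1) * U * Y + V * U ^ (k + 1) + k * V * U ^ (k + 1) := by
        rw [h, mul_add, hc, ← mul_assoc]
      _ = _ := by rw [← pow_succ]; push_cast; noncomm_ring

/-- If `y` is of degree one and acts on a transcendental element `t` by `y t = t y + z t` with `z`
central, then `(z t)⁻¹ y` and `t` generate a copy of the first Weyl algebra. -/
theorem IsOreExtension.exists_weylAlgebraOne [NoZeroDivisors R] [Nontrivial R]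
    {σ : R ≃ₐ[K] R} {δ : R →ₗ[K] R} {ι : R →ₐ[K] S} {x : S} (hS : IsOreExtension σ δ ι x)
    {δ' : R →ₗ[K] R} (hδ' : IsSkewDerivation AlgEquiv.refl δ') {y : S}
    (hy : HasDegree ι x 1 y) (hyr : ∀ r, y * ι r = ι r * y + ι (δ' r)) {t z : R}
    (ht : Transcendental K t) (hz : ∀ r, Commute z r) (hz0 : z ≠ 0) (htz : δ' t = z * t)
    {f : S →ₐ[K] D} (hf : Function.Injective f) :
    ∃ g : WeylAlgebraOne K →ₐ[K] D, Function.Injective g := by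
  set F : R →ₐ[K] D := f.comp ι
  have hFinj : Function.Injective F := hf.comp hS.injective
  have ht0 : t ≠ 0 := fun h => ht (h ▸ isAlgebraic_zero)
  obtain ⟨u, hu⟩ : ∃ u, u = z * t := ⟨_, rfl⟩
  have hu0 : u ≠ 0 := hu ▸ mul_ne_zero hz0 ht0
  have hFu : F u ≠ 0 := (map_ne_zero_iff F hFinj).2 hu0
  have hut : Commute u t := hu ▸ (hz t).mul_left (Commute.refl t)
  -- A derivation preserves the centre: apply `δ'` to `z r = r z`.
  have hδz : ∀ r, Commute (δ' z) r := fun r => by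
    have h1 := congrArg δ' (hz r).eq
    rw [hδ', hδ', AlgEquiv.coe_refl, id, id, (hz (δ' r)).eq, add_comm] at h1
    exact add_right_cancel h1
  have hδu : Commute (δ' u) u := by
    have h : δ' u = (z * z + δ' z) * t := by
      rw [hu, hδ', htz, AlgEquiv.coe_refl, id, add_mul, mul_assoc]
    have hc : ∀ r, Commute (z * z + δ' z) r := fun r => ((hz r).mul_left (hz r)).add_left (hδz r)
    rw [h]
    exact (hc u).mul_left hut.symm
  set Y := f y with hY
  have hYr : ∀ r, Y * F r = F r * Y + F (δ' r) := fun r => by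
    have := congrArg f (hyr r)
    rwa [map_mul, map_add, map_mul] at this
  have hcomm : ∀ r, Commute u r → Commute (F u) (F r) := fun r h => h.map F
  have hpq : (F u)⁻¹ * Y * F t - F t * ((F u)⁻¹ * Y) = 1 := by
    have : F t * (F u)⁻¹ = (F u)⁻¹ * F t := ((hcomm t hut).inv_left₀).eq.symm
    rw [mul_assoc, hYr, htz, ← hu, mul_add, inv_mul_cancel₀ hFu, ← mul_assoc, ← mul_assoc, this]
    noncomm_ring
  -- With `p = u⁻¹ Y`, these elements represent `u^(2j) p^j` inside `S`. The recursion comes from `u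
  -- Y u^(2j) = u^(2j+1) Y + 2j δ'(u) u^(2j)`; the subtracted term has degree `0`, so each factor
  -- still has degree `1`, even in positive characteristic.
  let h : ℕ → S := fun j => Nat.rec 1 (fun j s => (ι u * y - (2 * j : ℕ) * ι (δ' u)) * s) j
  have hsucc : ∀ j, h (j + 1) = (ι u * y - (2 * j : ℕ) * ι (δ' u)) * h j := fun _ => rfl
  have hfh : ∀ j, f (h j) = F u ^ (2 * j) * ((F u)⁻¹ * Y) ^ j := fun j => by
    induction j with
    | zero => simp [h]
    | succ j ih =>
      have hcomm' := mul_mul_pow_of_commute (hYr u) (hδu.map F) (2 * j)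
      rw [hsucc, map_mul, ih, pow_succ' _ j, map_sub, map_mul, map_mul f (Nat.cast _), map_natCast]
      change (F u * Y - _ * F _) * _ = _
      rw [sub_mul, ← mul_assoc, hcomm', ← mul_assoc _ (F u ^ (2 * j)), add_mul,
        add_sub_cancel_right, mul_add, mul_one, pow_succ _ (2 * j + 1)]
      simp only [mul_assoc, mul_inv_cancel_left₀ hFu]
  have hdeg : ∀ j, HasDegree ι x j (h j) := fun j => by
    induction j with
    | zero => simpa [h] using hasDegree_coe (ι := ι) (x := x) (one_ne_zero (α := R))
    | succ j ih =>
      have h1 : HasDegree ι x 1 (ι u * y - (2 * j : ℕ) * ι (δ' u)) := by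
        have := (hasDegree_coe (ι := ι) (x := x) hu0).mul hS hy
        rw [zero_add] at this
        rw [sub_eq_add_neg]
        refine this.add (neg_mem ?_)
        have := mul_pow_mem_degreeLT (ι := ι) (x := x) one_pos ((2 * j : ℕ) * δ' u)
        rwa [pow_zero, mul_one, map_mul, map_natCast] at this
      rw [hsucc, add_comm]
      exact h1.mul hS ih
  refine ⟨WeylAlgebraOne.lift _ _ hpq, ?_⟩
  rw [injective_iff_map_eq_zero]
  intro w hw
  obtain ⟨c, rfl⟩ := WeylAlgebraOne.exists_eq_sum w
  set g := WeylAlgebraOne.lift (K := K) ((F u)⁻¹ * Y) (F t) hpq with hg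
  have hgp : g (WeylAlgebraOne.gen K 0) = (F u)⁻¹ * Y := WeylAlgebraOne.lift_gen _ _ hpq 0
  have hgq : g (WeylAlgebraOne.gen K 1) = F t := WeylAlgebraOne.lift_gen _ _ hpq 1
  have hcu : ∀ r : Polynomial K, Commute u (Polynomial.aeval t r) := fun r => by
    induction r using Polynomial.induction_on' with
    | add a b ha hb => rw [map_add]; exact ha.add_right hb
    | monomial k a =>
      rw [Polynomial.aeval_monomial]
      exact (show Commute u _ from (Algebra.commutes a u).symm).mul_right (hut.pow_right k)
  have hle : ∀ j ∈ c.support, j ≤ c.support.sup id := fun j hj => Finset.le_sup (f := id) hj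
  set N := c.support.sup id
  -- Multiply the relation `∑ c_j(t) p^j = 0` by `u^(2N)`, where `u` commutes with each `c_j(t)`.
  -- This gives a left `R`-linear relation among elements of distinct degrees.
  have hsum : ∑ j ∈ c.support, ι (Polynomial.aeval t (c j) * u ^ (2 * (N - j))) * h j = 0 := by
    apply hf
    rw [map_zero, map_sum, ← mul_zero (F u ^ (2 * N)), ← hw, Finsupp.sum, map_sum, Finset.mul_sum]
    refine Finset.sum_congr rfl fun j hj => ?_
    rw [map_mul f, hfh, map_mul g, map_pow, hgp, ← Polynomial.aeval_algHom_apply, hgq,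
      Polynomial.aeval_algHom_apply, ← mul_assoc, ← mul_assoc]
    congr 1
    change F _ * _ = _
    rw [map_mul, map_pow, mul_assoc, ← pow_add, ← (((hcomm _ (hcu (c j))).pow_left _).eq)]
    congr 2
    have := hle j hj
    omega
  have hc : c = 0 := by
    rw [← Finsupp.support_eq_empty, Finset.eq_empty_iff_forall_notMem]
    intro j hj
    have := hS.eq_zero_of_sum_eq_zero hdeg hsum j hj
    rw [mul_eq_zero, or_iff_left (pow_ne_zero _ hu0)] at this
    exact Finsupp.mem_support_iff.1 hj (transcendental_iff.1 ht _ this)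
  rw [hc, Finsupp.sum_zero_index]

end Derivation

/-! ### Inner automorphism, outer derivation -/

namespace QuantumTorus

variable {K : Type*} [Field K] {n : ℕ} {Q : Matrix (Fin n) (Fin n) K}

/-- The powers of a generator are non-zero multiples of distinct monomials. -/
theorem transcendental_x (hQ : IsMultAntisymm Q) (i : Fin n) : Transcendental K (x Q i) := by
  have hpow : ∀ k : ℕ, ∃ c : K, c ≠ 0 ∧
      x Q i ^ k = c • (monomial hQ (k • Pi.single i 1) : QuantumTorus Q) := fun k => by
    induction k with
    | zero =>
      obtain ⟨c, hc, h⟩ := monomial_zero hQ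
      exact ⟨c⁻¹, inv_ne_zero hc, by rw [zero_smul, h, inv_smul_smul₀ hc, pow_zero]⟩
    | succ k ih =>
      obtain ⟨c, hc, h⟩ := ih
      obtain ⟨d, hd, h'⟩ := monomial_single hQ i
      obtain ⟨e, he, h''⟩ := monomial_mul hQ (k • Pi.single i 1) (Pi.single i 1)
      refine ⟨c * d⁻¹ * e, by positivity, ?_⟩
      rw [succ_nsmul, mul_smul, ← h'', h', mul_smul_comm, smul_smul, inv_mul_cancel_right₀ hd,
        ← smul_mul_assoc, ← h, pow_succ]
  choose c hc h using hpow
  have hinj : Function.Injective fun k : ℕ => k • (Pi.single i 1 : Fin n → ℤ) := fun k l hkl => by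
    simpa using congrFun hkl i
  have hli := ((linearIndependent_monomial hQ).comp _ hinj).units_smul fun k =>
    Units.mk0 (c k) (hc k)
  rw [transcendental_iff]
  intro p hp
  rw [Polynomial.aeval_eq_sum_range] at hp
  rw [linearIndependent_iff'] at hli
  ext k
  by_cases hk : k < p.natDegree + 1
  · refine hli (Finset.range (p.natDegree + 1)) p.coeff ?_ k (Finset.mem_range.2 hk)
    rw [← hp]
    exact Finset.sum_congr rfl fun j _ => congrArg _ (h j).symm
  · rw [Polynomial.coeff_eq_zero_of_natDegree_lt (by omega), Polynomial.coeff_zero]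

/-- If `σ` is inner and `δ` is outer, the quotient division algebra of the Ore extension contains
the first Weyl algebra. -/
theorem exists_weylAlgebraOne (hQ : IsMultAntisymm Q) {σ : QuantumTorus Q ≃ₐ[K] QuantumTorus Q}
    {δ : QuantumTorus Q →ₗ[K] QuantumTorus Q} (hδ : IsSkewDerivation σ δ)
    {S D : Type*} [Ring S] [Algebra K S] {ι : QuantumTorus Q →ₐ[K] S} {x : S}
    (hS : IsOreExtension σ δ ι x) (hσ : IsInnerAut σ) (hδo : ¬ IsInnerSkewDerivation σ δ)
    [DivisionRing D] [Algebra K D] {f : S →ₐ[K] D} (hf : Function.Injective f) :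
    ∃ g : WeylAlgebraOne K →ₐ[K] D, Function.Injective g := by
  have := noZeroDivisors hQ
  have := nontrivial hQ
  obtain ⟨s, hs⟩ := hσ
  have hsσ : ∀ r, ↑s * σ r = r * s := fun r => by rw [hs, mul_assoc, Units.mul_inv_cancel_left]
  -- Since `s σ(r) = r s`, multiplying by `s` untwists `δ` into an ordinary derivation.
  let δs : QuantumTorus Q →ₗ[K] QuantumTorus Q := LinearMap.mulLeft K ↑s ∘ₗ δ
  have hδs : IsSkewDerivation AlgEquiv.refl δs := fun r t => by
    change ↑s * δ (r * t) = r * (↑s * δ t) + ↑s * δ r * t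
    rw [hδ, mul_add, ← mul_assoc, hsσ]
    simp only [mul_assoc]
  obtain ⟨a, m, hm, hγ⟩ := exists_sub_inner hQ (σ := AlgEquiv.refl)
    ⟨fun _ => 1, fun _ => one_ne_zero, fun i => (one_smul K _).symm⟩ hδs
  have hδ' := hδs.sub_inner a
  set δ' := δs - innerSkewDerivation AlgEquiv.refl a with hδ'def
  have hδ'x : ∀ i, δ' (QuantumTorus.x Q i) = m i * QuantumTorus.x Q i := hm
  -- For the identity automorphism, a monomial implementing it is central.
  have hcentral : ∀ i r, Commute (m i) r := fun i r => by
    rw [← (basis hQ).linearCombination_repr (m i), Finsupp.linearCombination_apply]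
    refine Finset.sum_induction _ (fun b => Commute b r) (fun _ _ ha hb => ha.add_left hb)
      (Commute.zero_left r) fun γ hγs => ?_
    have : Commute (monomial hQ γ : QuantumTorus Q) r :=
      hγ i γ (Finsupp.mem_support_iff.1 hγs) r
    simpa only [basis_apply] using this.smul_left _
  have hne : ∃ i, m i ≠ 0 := by
    by_contra! h0
    -- If `s δ(r) = a r - r a`, then `δ(r) = s⁻¹ a r - σ(r) s⁻¹ a`.
    refine hδo ⟨↑s⁻¹ * a, fun r => ?_⟩
    have hr := skewDerivation_eq_zero hδ' (fun i => by rw [hδ'x, h0, zero_mul]) r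
    have hr' : ↑s * δ r = a * r - r * a := sub_eq_zero.1 hr
    have := congrArg (fun b => (↑s⁻¹ : QuantumTorus Q) * b) hr'
    simp only [Units.inv_mul_cancel_left, mul_sub] at this
    rw [this, hs]
    simp only [mul_assoc, Units.mul_inv_cancel_left]
  obtain ⟨i, hi⟩ := hne
  refine hS.exists_weylAlgebraOne hδ' (y := ι s * x + -ι a) ?_ (fun r => ?_)
    (transcendental_x hQ i) (hcentral i) hi (hδ'x i) hf
  · refine (IsOreExtension.hasDegree_coe_mul s.ne_zero).add (neg_mem ?_)
    have := IsOreExtension.mul_pow_mem_degreeLT (ι := ι) (x := x) one_pos a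
    simpa using this
  · have h1 : ι (δ' r) = ι s * ι (δ r) - (ι a * ι r - ι r * ι a) := by
      rw [← map_mul, ← map_mul, ← map_mul, ← map_sub, ← map_sub]
      rfl
    have h2 : ι s * ι (σ r) = ι r * ι s := by rw [← map_mul, hsσ, map_mul]
    rw [add_mul, mul_assoc, hS.comm, mul_add, ← mul_assoc, h2, h1]
    noncomm_ring

end QuantumTorus

/-! ### Inner derivations and the enlarged quantum torus -/

namespace QuantumTorus

variable {K : Type*} [Field K] {n : ℕ} {Q : Matrix (Fin n) (Fin n) K}

/-- Over a quantum torus, every `σ`-derivation for a toric outer automorphism `σ` is inner. -/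
theorem isInnerSkewDerivation_of_outer (hQ : IsMultAntisymm Q)
    {σ : QuantumTorus Q ≃ₐ[K] QuantumTorus Q} (hσ : IsToric σ)
    {δ : QuantumTorus Q →ₗ[K] QuantumTorus Q} (hδ : IsSkewDerivation σ δ) (ho : ¬ IsInnerAut σ) :
    IsInnerSkewDerivation σ δ := by
  obtain ⟨a, m, hm, hγ⟩ := exists_sub_inner hQ hσ hδ
  have hm0 : ∀ i, m i = 0 := by
    intro i
    rw [← (basis hQ).repr.map_eq_zero_iff]
    ext γ
    by_contra hne
    -- From `x^γ r = σ(r) x^γ`; the inverse matches the convention `σ r = s⁻¹ r s`.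
    refine ho ⟨(monomial hQ γ)⁻¹, fun r => ?_⟩
    rw [inv_inv, (hγ i γ hne r).eq, mul_assoc, Units.mul_inv, mul_one]
  refine ⟨a, fun r => ?_⟩
  have := skewDerivation_eq_zero (hδ.sub_inner a) (fun i => by
    rw [LinearMap.sub_apply, innerSkewDerivation_apply, hm, hm0, zero_mul]) r
  exact sub_eq_zero.1 this

/-- The matrix of the quantum torus generated by `y, x_1, …, x_n` with `y x_i = λ_i x_i y`. -/
def consMatrix (Q : Matrix (Fin n) (Fin n) K) (Λ : Fin n → K) :
    Matrix (Fin (n + 1)) (Fin (n + 1)) K :=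
  Matrix.of <| Fin.cons (Fin.cons 1 Λ) fun i => Fin.cons (Λ i)⁻¹ (Q i)

theorem isMultAntisymm_consMatrix (hQ : IsMultAntisymm Q) {Λ : Fin n → K} (hΛ : ∀ i, Λ i ≠ 0) :
    IsMultAntisymm (consMatrix Q Λ) where
  diag i := by
    cases i using Fin.cases with
    | zero => simp [consMatrix]
    | succ i => simp [consMatrix, hQ.diag]
  ne_zero i j := by
    cases i using Fin.cases <;> cases j using Fin.cases <;>
      simp [consMatrix, hQ.ne_zero, hΛ]
  inv i j := by
    cases i using Fin.cases <;> cases j using Fin.cases <;> simp [consMatrix]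
    exact hQ.inv _ _

section

variable {D : Type*} [DivisionRing D] [Algebra K D] {F : QuantumTorus Q →ₐ[K] D} {Y : D}
  {Λ : Fin n → K}

/-- The homomorphism from the quantum torus of `consMatrix Q Λ` extending `F` and sending the
additional generator to `Y`. -/
noncomputable def consLift (F : QuantumTorus Q →ₐ[K] D) (hY : Y ≠ 0)
    (hYx : ∀ i, Y * F (x Q i) = Λ i • (F (x Q i) * Y)) :
    QuantumTorus (consMatrix Q Λ) →ₐ[K] D :=
  lift (Fin.cons (Units.mk0 Y hY) fun i => Units.map (F : QuantumTorus Q →* D) (gen Q i)) <| by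
    intro i j hij
    cases j using Fin.cases with
    | zero => exact absurd hij (Fin.not_lt_zero i)
    | succ j =>
      cases i using Fin.cases with
      | zero => simpa [consMatrix] using hYx j
      | succ i =>
        have h : x Q i * x Q j = Q i j • (x Q j * x Q i) := by
          rw [x, x, ← map_mul, RingQuot.mkAlgHom_rel K
            (QuantumTorusRel.comm i j (Fin.succ_lt_succ_iff.1 hij)), map_smul, map_mul]
        simpa [consMatrix] using congrArg F h

variable (hY : Y ≠ 0) (hYx : ∀ i, Y * F (x Q i) = Λ i • (F (x Q i) * Y))

theorem consLift_x_zero : consLift F hY hYx (x _ 0) = Y := by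
  rw [consLift, lift_x]; rfl

theorem consLift_x_succ (i : Fin n) : consLift F hY hYx (x _ i.succ) = F (x Q i) := by
  rw [consLift, lift_x]; rfl

theorem zpow_mul_monomial (hQ : IsMultAntisymm Q) (hΛ : ∀ i, Λ i ≠ 0)
    (hYx : ∀ i, Y * F (x Q i) = Λ i • (F (x Q i) * Y)) (k : ℤ) (α : Fin n → ℤ) :
    ∃ c : K, c ≠ 0 ∧ Y ^ k * F (monomial hQ α) = c • (F (monomial hQ α) * Y ^ k) := by
  -- Stated as a semiconjugation, the relation passes to products and inverses of monomials, and
  -- then to integer powers of `Y`.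
  have h1 : ∃ c : K, c ≠ 0 ∧ SemiconjBy (F (monomial hQ α)) (algebraMap K D c * Y) Y := by
    refine monomial_induction hQ (P := fun _ u => ∃ c : K, c ≠ 0 ∧
      SemiconjBy (F u) (algebraMap K D c * Y) Y) ?_ ?_ ?_ ?_ ?_ α
    · rintro c - u v hc h ⟨d, hd, hu⟩
      refine ⟨d, hd, ?_⟩
      rw [h, map_smul, Algebra.smul_def]
      exact SemiconjBy.mul_left (show Commute _ _ from Algebra.commutes c Y) hu
    · exact ⟨1, one_ne_zero, by simp⟩
    · rintro - - u v ⟨c, hc, hu⟩ ⟨d, hd, hv⟩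
      refine ⟨c * d, mul_ne_zero hc hd, ?_⟩
      rw [Units.val_mul, map_mul]
      refine hu.mul_left ?_
      rw [map_mul, mul_assoc]
      exact SemiconjBy.mul_right (show Commute _ _ from (Algebra.commutes c _).symm) hv
    · rintro - u ⟨c, hc, hu⟩
      refine ⟨c⁻¹, inv_ne_zero hc, ?_⟩
      have hu' : SemiconjBy (F ↑u⁻¹) Y (algebraMap K D c * Y) := by
        have hs : SemiconjBy (↑(Units.map (F : QuantumTorus Q →* D) u)) (algebraMap K D c * Y) Y :=
          hu
        simpa [← map_inv] using hs.units_inv_symm_left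
      have h2 := SemiconjBy.mul_right (show Commute (F ↑u⁻¹) (algebraMap K D c⁻¹) from
        (Algebra.commutes c⁻¹ _).symm) hu'
      rwa [← mul_assoc (algebraMap K D c⁻¹), ← map_mul, inv_mul_cancel₀ hc, map_one, one_mul] at h2
    · intro i
      refine ⟨Λ i, hΛ i, ?_⟩
      rw [SemiconjBy, val_gen, hYx, ← Algebra.smul_def, mul_smul_comm]
  obtain ⟨c, hc, h⟩ := h1
  refine ⟨c ^ k, zpow_ne_zero k hc, ?_⟩
  rw [← (h.zpow_right₀ k).eq,
    (show Commute (algebraMap K D c) Y from Algebra.commutes c Y).mul_zpow, ← map_zpow₀,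
    ← Algebra.smul_def, mul_smul_comm]

theorem consLift_monomial (hQ : IsMultAntisymm Q) (hΛ : ∀ i, Λ i ≠ 0)
    (α : Fin (n + 1) → ℤ) :
    ∃ c : K, c ≠ 0 ∧ consLift F hY hYx (monomial (isMultAntisymm_consMatrix hQ hΛ) α) =
      c • (F (monomial hQ (Fin.tail α)) * Y ^ α 0) := by
  refine monomial_induction (isMultAntisymm_consMatrix hQ hΛ) (P := fun α u => ∃ c : K, c ≠ 0 ∧
    consLift F hY hYx u = c • (F (monomial hQ (Fin.tail α)) * Y ^ α 0)) ?_ ?_ ?_ ?_ ?_ α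
  · rintro c α u v hc h ⟨d, hd, hu⟩
    exact ⟨c * d, mul_ne_zero hc hd, by rw [h, map_smul, hu, smul_smul]⟩
  · obtain ⟨c, hc, h⟩ := monomial_zero hQ
    refine ⟨c⁻¹, inv_ne_zero hc, ?_⟩
    have : Fin.tail (0 : Fin (n + 1) → ℤ) = 0 := rfl
    rw [this, h, map_smul, smul_mul_assoc, inv_smul_smul₀ hc]
    simp
  · rintro α β u v ⟨c, hc, hu⟩ ⟨d, hd, hv⟩
    obtain ⟨e, he, h⟩ := zpow_mul_monomial hQ hΛ hYx (α 0) (Fin.tail β)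
    obtain ⟨e', he', h'⟩ := monomial_mul hQ (Fin.tail α) (Fin.tail β)
    refine ⟨c * d * e * e', by simp [hc, hd, he, he'], ?_⟩
    have ht : Fin.tail (α + β) = Fin.tail α + Fin.tail β := rfl
    calc consLift F hY hYx ↑(u * v)
        = (c * d) • (F (monomial hQ (Fin.tail α)) * (Y ^ α 0 * F (monomial hQ (Fin.tail β))) *
            Y ^ β 0) := by
          rw [Units.val_mul, map_mul, hu, hv, smul_mul_smul_comm]; simp only [mul_assoc]
      _ = (c * d * e) • (F (monomial hQ (Fin.tail α) * monomial hQ (Fin.tail β)) *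
            Y ^ (α 0 + β 0)) := by
          rw [h, zpow_add₀ hY, map_mul, mul_smul_comm, smul_mul_assoc, smul_smul]
          simp only [mul_assoc]
      _ = _ := by rw [h', map_smul, smul_mul_assoc, smul_smul, ht, Pi.add_apply]
  · rintro α u ⟨c, hc, hu⟩
    obtain ⟨e, he, h⟩ := zpow_mul_monomial hQ hΛ hYx (-α 0) (Fin.tail (-α))
    obtain ⟨e', he', h'⟩ := monomial_neg hQ (Fin.tail α)
    have ht : Fin.tail (-α) = -Fin.tail α := rfl
    refine ⟨c⁻¹ * e'⁻¹ * e, by simp [hc, he, he'], ?_⟩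
    have h1 : consLift F hY hYx ↑u⁻¹ = (consLift F hY hYx u)⁻¹ := by
      refine eq_inv_of_mul_eq_one_left ?_
      rw [← map_mul, Units.inv_mul, map_one]
    have h2 : (F (monomial hQ (Fin.tail α)))⁻¹ = e'⁻¹ • F (monomial hQ (Fin.tail (-α))) := by
      rw [ht, h', map_smul, inv_smul_smul₀ he']
      refine (eq_inv_of_mul_eq_one_left ?_).symm
      rw [← map_mul, Units.inv_mul, map_one]
    have h3 : (c • (F (monomial hQ (Fin.tail α)) * Y ^ α 0))⁻¹ =
        c⁻¹ • ((Y ^ α 0)⁻¹ * (F (monomial hQ (Fin.tail α)))⁻¹) := by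
      rw [Algebra.smul_def, mul_inv_rev, mul_inv_rev, ← map_inv₀ (algebraMap K D),
        ← Algebra.commutes, ← Algebra.smul_def]
    rw [h1, hu, h3, h2, ← zpow_neg, mul_smul_comm, h, smul_smul, smul_smul, Pi.neg_apply]
  · intro i
    cases i using Fin.cases with
    | zero =>
      obtain ⟨c, hc, h⟩ := monomial_zero hQ
      refine ⟨c⁻¹, inv_ne_zero hc, ?_⟩
      have : Fin.tail (Pi.single 0 1 : Fin (n + 1) → ℤ) = 0 := by
        ext j; simp [Fin.tail]
      rw [this, h, map_smul, smul_mul_assoc, inv_smul_smul₀ hc, val_gen, consLift_x_zero]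
      simp
    | succ i =>
      obtain ⟨c, hc, h⟩ := monomial_single hQ i
      refine ⟨c⁻¹, inv_ne_zero hc, ?_⟩
      have : Fin.tail (Pi.single i.succ 1 : Fin (n + 1) → ℤ) = Pi.single i 1 := by
        ext j
        simp [Fin.tail, Pi.single_apply]
      rw [this, h, map_smul, smul_mul_assoc, inv_smul_smul₀ hc, val_gen, consLift_x_succ]
      simp

/-- View `D` as a left module over the torus through `F`. The integer powers of `Y` are independent
over the torus and the monomials over `K`, so their products are independent over `K`; up to scalars
these are the images of the monomial basis. -/
theorem consLift_injective (hQ : IsMultAntisymm Q) (hΛ : ∀ i, Λ i ≠ 0)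
    (hli : ∀ (s : Finset ℕ) (c : ℕ → QuantumTorus Q),
      ∑ i ∈ s, F (c i) * Y ^ i = 0 → ∀ i ∈ s, c i = 0) :
    Function.Injective (consLift F hY hYx) := by
  classical
  let _ : Module (QuantumTorus Q) D := Module.compHom D (F : QuantumTorus Q →+* D)
  have hsmul : ∀ (r : QuantumTorus Q) (d : D), r • d = F r * d := fun _ _ => rfl
  have : IsScalarTower K (QuantumTorus Q) D := ⟨fun c r d => by
    rw [hsmul, hsmul, map_smul, smul_mul_assoc]⟩
  have hY' : LinearIndependent (QuantumTorus Q) fun k : ℤ => Y ^ k := by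
    rw [linearIndependent_iff']
    intro s g hg
    -- Right multiplication by `Y^N` makes all exponents non-negative, so that `hli` applies.
    set N : ℤ := ∑ k ∈ s, |k|
    have hN : ∀ k ∈ s, 0 ≤ k + N := fun k hk => by
      have := Finset.single_le_sum (f := fun k : ℤ => |k|) (fun _ _ => abs_nonneg _) hk
      have h2 := neg_abs_le k
      omega
    have hinj : Set.InjOn (fun k : ℤ => (k + N).toNat) s := fun k hk l hl h => by
      have := hN k hk
      have := hN l hl
      dsimp only at h
      omega
    have hsum : ∑ i ∈ s.image fun k : ℤ => (k + N).toNat, F (g (i - N)) * Y ^ i = 0 := by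
      rw [Finset.sum_image hinj]
      have := congrArg (· * Y ^ N) hg
      simp only [zero_mul, Finset.sum_mul] at this
      rw [← this]
      refine Finset.sum_congr rfl fun k hk => ?_
      rw [Int.toNat_of_nonneg (hN k hk), add_sub_cancel_right, hsmul, mul_assoc, ← zpow_add₀ hY,
        ← zpow_natCast, Int.toNat_of_nonneg (hN k hk)]
    intro k hk
    have := hli _ (fun i => g (i - N)) hsum _ (Finset.mem_image_of_mem _ hk)
    rwa [Int.toNat_of_nonneg (hN k hk), add_sub_cancel_right] at this
  have hprod := linearIndependent_smul (linearIndependent_monomial hQ) hY'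
  have hinj : Function.Injective fun α : Fin (n + 1) → ℤ => (Fin.tail α, α 0) := fun α β h => by
    obtain ⟨h1, h2⟩ := Prod.ext_iff.1 h
    dsimp only at h1 h2
    rw [← Fin.cons_self_tail α, ← Fin.cons_self_tail β, h1, h2]
  choose c hc hmon using consLift_monomial hY hYx hQ hΛ
  have hfin := (hprod.comp _ hinj).units_smul fun α => Units.mk0 (c α) (hc α)
  have heq : ((fun α => Units.mk0 (c α) (hc α)) •
      ((fun p : (Fin n → ℤ) × ℤ => (monomial hQ p.1 : QuantumTorus Q) • Y ^ p.2) ∘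
        fun α : Fin (n + 1) → ℤ => (Fin.tail α, α 0))) =
      fun α => consLift F hY hYx (basis (isMultAntisymm_consMatrix hQ hΛ) α) := by
    ext α
    rw [basis_apply, hmon]
    rfl
  rw [heq, LinearIndependent] at hfin
  rw [injective_iff_map_eq_zero]
  intro a ha
  rw [← (basis (isMultAntisymm_consMatrix hQ hΛ)).repr.map_eq_zero_iff]
  apply hfin
  rw [map_zero, ← ha]
  conv_rhs => rw [← (basis (isMultAntisymm_consMatrix hQ hΛ)).linearCombination_repr a]
  simp [Finsupp.linearCombination_apply, Finsupp.sum, map_sum, map_smul]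

end

/-- If `δ` is inner, the quotient division algebra of the Ore extension is that of a quantum torus
with one more generator. -/
theorem isQuotientDivisionAlgebra_consMatrix (hQ : IsMultAntisymm Q)
    {σ : QuantumTorus Q ≃ₐ[K] QuantumTorus Q} {Λ : Fin n → K} (hΛ : ∀ i, Λ i ≠ 0)
    (hσ : ∀ i, σ (x Q i) = Λ i • x Q i) {δ : QuantumTorus Q →ₗ[K] QuantumTorus Q}
    (hδ : IsInnerSkewDerivation σ δ) {S D : Type*} [Ring S] [Algebra K S]
    {ι : QuantumTorus Q →ₐ[K] S} {x : S} (hS : IsOreExtension σ δ ι x)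
    [DivisionRing D] [Algebra K D] {f : S →ₐ[K] D} (hf : IsQuotientDivisionAlgebra f) :
    ∃ h : QuantumTorus (consMatrix Q Λ) →ₐ[K] D, IsQuotientDivisionAlgebra h := by
  have := noZeroDivisors hQ
  have := nontrivial hQ
  obtain ⟨a, ha⟩ := hδ
  -- Subtracting `a` absorbs the inner derivation, leaving `y r = σ(r) y`.
  obtain ⟨y, hy⟩ : ∃ y, y = x + -ι a := ⟨_, rfl⟩
  have hdeg : IsOreExtension.HasDegree ι x 1 y := by
    have h1 := IsOreExtension.hasDegree_coe_mul (ι := ι) (x := x)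
      (one_ne_zero (α := QuantumTorus Q))
    rw [map_one, one_mul] at h1
    rw [hy]
    refine h1.add (neg_mem ?_)
    simpa using IsOreExtension.mul_pow_mem_degreeLT (ι := ι) (x := x) one_pos a
  have hyr : ∀ r, y * ι r = ι (σ r) * y := fun r => by
    rw [hy, add_mul, hS.comm, ha, map_sub, map_mul, map_mul]
    noncomm_ring
  set F := f.comp ι
  have hY : f y ≠ 0 := (map_ne_zero_iff f hf.injective).2 (hdeg.ne_zero hS)
  have hYx : ∀ i, f y * F (QuantumTorus.x Q i) = Λ i • (F (QuantumTorus.x Q i) * f y) := fun i => by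
    have := congrArg f (hyr (QuantumTorus.x Q i))
    rw [hσ, map_smul, smul_mul_assoc, map_smul, map_mul, map_mul] at this
    exact this
  have hinj : Function.Injective (consLift F hY hYx) := by
    refine consLift_injective hY hYx hQ hΛ fun s c hc => ?_
    refine hS.eq_zero_of_sum_eq_zero (hdeg.pow hS) (hf.injective ?_)
    rw [map_zero, ← hc, map_sum]
    refine Finset.sum_congr rfl fun i _ => ?_
    rw [map_mul, map_pow]
    rfl
  obtain ⟨h, hzero, hsucc, hinj⟩ : ∃ h : QuantumTorus (consMatrix Q Λ) →ₐ[K] D,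
      h (QuantumTorus.x _ 0) = f y ∧
      (∀ i : Fin n, h (QuantumTorus.x _ i.succ) = F (QuantumTorus.x Q i)) ∧
      Function.Injective h :=
    ⟨_, consLift_x_zero hY hYx, consLift_x_succ hY hYx, hinj⟩
  -- The image of the torus contains `f(S)`, so numerators and denominators from `S` lift to it.
  have hrange : ∀ s, f s ∈ h.range := by
    have hT : ∀ r, f (ι r) ∈ h.range := fun r => by
      induction r using induction with
      | algebraMap c => rw [AlgHom.commutes, AlgHom.commutes]; exact Subalgebra.algebraMap_mem _ c
      | add a b ha hb => rw [map_add, map_add]; exact add_mem ha hb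
      | mul a b ha hb => rw [map_mul, map_mul]; exact mul_mem ha hb
      | gen i => exact ⟨_, hsucc i⟩
      | gen_inv i =>
        refine ⟨(↑(gen (consMatrix Q Λ) i.succ)⁻¹ : QuantumTorus (consMatrix Q Λ)), ?_⟩
        refine left_inv_eq_right_inv (a := F (QuantumTorus.x Q i)) ?_ ?_
        · change h _ * _ = 1
          rw [← hsucc i, ← map_mul, ← val_gen, Units.inv_mul, map_one]
        · change F _ * F _ = 1
          rw [← map_mul, ← val_gen, Units.mul_inv, map_one]
    have hle : Algebra.adjoin K (Set.range ι ∪ {x}) ≤ h.range.comap f := by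
      rw [Algebra.adjoin_le_iff]
      rintro s (⟨r, rfl⟩ | hs)
      · exact hT r
      · rw [Set.mem_singleton_iff.1 hs]
        have h0 : f y ∈ h.range := ⟨_, hzero⟩
        have := add_mem h0 (hT a)
        rwa [← map_add, hy, neg_add_cancel_right] at this
    rw [hS.adjoin_eq_top] at hle
    exact fun s => hle trivial
  have hne : ∀ s t, s ≠ 0 → h t = f s → t ≠ 0 := by
    rintro s _ hs hts rfl
    rw [map_zero] at hts
    exact hs ((map_eq_zero_iff f hf.injective).1 hts.symm)
  refine ⟨h, hinj, fun d => ?_, fun d => ?_⟩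
  · obtain ⟨b, s, hs, rfl⟩ := hf.right_fraction d
    obtain ⟨b', hb'⟩ := hrange b
    obtain ⟨s', hs'⟩ := hrange s
    exact ⟨b', s', hne s s' hs hs', congrArg₂ (fun b s => b * s⁻¹) hb'.symm hs'.symm⟩
  · obtain ⟨b, s, hs, rfl⟩ := hf.left_fraction d
    obtain ⟨b', hb'⟩ := hrange b
    obtain ⟨s', hs'⟩ := hrange s
    exact ⟨b', s', hne s s' hs hs', congrArg₂ (fun b s => s⁻¹ * b) hb'.symm hs'.symm⟩

end QuantumTorus

/-! ### Assembly -/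

theorem mainTheorem4 {K : Type u} [Field K] {n : ℕ}
    (Q : Matrix (Fin n) (Fin n) K) (hQ : IsMultAntisymm Q)
    (σ : QuantumTorus Q ≃ₐ[K] QuantumTorus Q) (hσ : IsToric σ)
    (δ : QuantumTorus Q →ₗ[K] QuantumTorus Q) (hδ : IsSkewDerivation σ δ)
    {S : Type w} [Ring S] [Algebra K S] (ι : QuantumTorus Q →ₐ[K] S) (x : S)
    (hS : IsOreExtension σ δ ι x) :
    (∃ (D : Type w) (_ : DivisionRing D) (_ : Algebra K D) (f : S →ₐ[K] D),
      IsQuotientDivisionAlgebra f) ∧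
    (IsInnerAut σ → ¬ IsInnerSkewDerivation σ δ →
      ∀ (D : Type v) [DivisionRing D] [Algebra K D] (f : S →ₐ[K] D),
        IsQuotientDivisionAlgebra f →
        ∃ g : WeylAlgebraOne K →ₐ[K] D, Function.Injective g) ∧
    (¬ IsInnerAut σ ∨ IsInnerSkewDerivation σ δ →
      ∃ Q' : Matrix (Fin (n + 1)) (Fin (n + 1)) K, IsMultAntisymm Q' ∧
        ∀ (D : Type v) [DivisionRing D] [Algebra K D] (f : S →ₐ[K] D),
          IsQuotientDivisionAlgebra f →
          ∃ h : QuantumTorus Q' →ₐ[K] D, IsQuotientDivisionAlgebra h) := by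
  refine ⟨?_, fun hi ho D _ _ f hf => QuantumTorus.exists_weylAlgebraOne hQ hδ hS hi ho hf.injective,
    fun h => ?_⟩
  · have := QuantumTorus.noZeroDivisors hQ
    have := hS.noZeroDivisors
    have := QuantumTorus.nontrivial hQ
    have := hS.injective.nontrivial
    exact exists_isQuotientDivisionAlgebra fun a b ha hb =>
      QuantumTorus.ore_oreExtension hQ hσ hδ hS ha hb
  · have hin : IsInnerSkewDerivation σ δ :=
      h.elim (QuantumTorus.isInnerSkewDerivation_of_outer hQ hσ hδ) id
    obtain ⟨Λ, hΛ, hx⟩ := hσ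
    -- The matrix depends only on `Q` and the eigenvalues of `σ`, so it serves every `D`.
    exact ⟨QuantumTorus.consMatrix Q Λ, QuantumTorus.isMultAntisymm_consMatrix hQ hΛ,
      fun D _ _ f hf => QuantumTorus.isQuotientDivisionAlgebra_consMatrix hQ hΛ hx hin hS hf⟩
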